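/- **Proposition.** *Setting.* Let $K$ be a field of characteristic $0$ (the constants) and $A$ a commutative $K$-algebra of functions of the times $t=(t_1,t_2,\dots)$, $t_1=x$, with commuting $K$-linear derivations $\partial/\partial t_n$; $\partial=\partial/\partial x$. Let $r\ge 1$ and $$L=L_++\sum_{i=1}^m\Phi_iD^{-1}\Psi_i ,\qquad L^{1/r}=D+O(D^{-1}),$$ be the Lax operator of a constrained KP hierarchy ${\sf cKP}_{r,m}$ over $A$: $\partial L/\partial t_n=[L^{n/r}_+,L]$, $\partial\Phi_i/\partial t_n=L^{n/r}_+(\Phi_i)$, $\partial\Psi_i/\partial t_n=-(L^*)^{n/r}_+(\Psi_i)$ for all $n\ge1$. Let $\tau$ be an invertible tau-function of it: $L=WD^rW^{-1}$ and $\partial W/\partial t_n=L^{n/r}_+W-WD^n$, where $W=\sum_{n\ge0}\frac{p_n(-[\partial])\tau}{\tau}D^{-n}$, $[\partial]=(\partial/\partial t_1,\frac12\partial/\partial t_2,\dots)$ and the $p_n$ are the Schur polynomials. *Squared eigenfunction potentials.* $S(f,g)$ is $K$-bilinear and satisfies $\partial S(f,g)/\partial t_n={\rm Res}(D^{-1}gL^{n/r}_+fD^{-1})$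 (so $\partial_xS(f,g)=fg$) for $f=L^i(\Phi_c)$, $g=(L^*)^j(\Psi_e)$, where $L(f)=L_+(f)+\sum_i\Phi_iS(f,\Psi_i)$ and $L^*(g)=(L^*)_+(g)-\sum_i\Psi_iS(\Phi_i,g)$. Fix $a\ne b$ and put $$\chi_a^{(i)}=L^i(\Phi_a),\qquad \chi_b^{*(j)}=(L^*)^j(\Psi_b),\qquad S_{ab}^{(i,j)}=S(\chi_a^{(i)},\chi_b^{*(j)}).$$ The additive constants in these are normalized so that integration by parts holds exactly: for $f=\chi_a^{(i)}$, $g=\chi_b^{*(j)}$, $i,j\ge0$, $$S(L(f),g)-S(f,L^*(g))=\partial S(f,g)/\partial t_r+\sum_{c}S(f,\Psi_c)S(\Phi_c,g).$$ *Darboux–Bäcklund (DB) transformations.* The DB transformation with respect to $\Phi_a$ (invertible), with $T=\Phi_aD\Phi_a^{-1}$, is $L\mapsto TLT^{-1}$, $\Phi_a\mapsto T(L(\Phi_a))$, $\Psi_a\mapsto1/\Phi_a$, $\Phi_i\mapsto T(\Phi_i)$ and $\Psi_i\mapsto -S(\Phi_a,\Psi_i)/\Phi_a$ for $i\ne a$,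 $\tau\mapsto\Phi_a\tau$. The adjoint DB transformation with respect to $\Psi_b$ (invertible), with $T=\Psi_bD\Psi_b^{-1}$, is $L\mapsto T^{*-1}LT^*$, $\Phi_b\mapsto-1/\Psi_b$, $\Psi_b\mapsto T(L^*(\Psi_b))$, $\Phi_i\mapsto-S(\Phi_i,\Psi_b)/\Psi_b$ and $\Psi_i\mapsto T(\Psi_i)$ for $i\neq b$, $\tau\mapsto\Psi_b\tau$. The transformed hierarchy carries $K$-bilinear potentials $\tilde S$, resp. $\bar S$, whose constants are fixed as follows, for $f=L^i(\Phi_c)$, $g=(L^*)^j(\Psi_e)$ with arbitrary $c,e,i,j$ (all objects on the right being those before the transformation): in the DB case $$\tilde S\Bigl(T(f),-\tfrac{S(\Phi_a,g)}{\Phi_a}\Bigr)=S(f,g)-\frac{f\,S(\Phi_a,g)}{\Phi_a},\qquad \tilde S\Bigl(T(f),\tfrac1{\Phi_a}\Bigr)\in\frac f{\Phi_a}+K;$$ in the adjoint case $$\bar S\Bigl(-\tfrac{S(f,\Psi_b)}{\Psi_b},T(g)\Bigr)=S(f,g)-\frac{g\,S(f,\Psi_b)}{\Psi_b},\qquad \bar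 S\Bigl(-\tfrac1{\Psi_b},T(g)\Bigr)\in-\frac g{\Psi_b}+K .$$ *Claim.* Start from a hierarchy as above, with tau-function $\tau^{(0,0)}$, and perform successively, in any order for which the functions to be inverted are invertible, $n\ge0$ DB transformations with respect to the current $\Phi_a$ and $k\ge0$ adjoint DB transformations with respect to the current $\Psi_b$. Let $\tau^{(n,k)}$ be the resulting tau-function. Let $W_p[f_1,\dots,f_p]=\det(\partial^{\alpha-1}f_\beta)_{\alpha,\beta=1}^p$ ($W_0=1$), and let $\chi_a^{(i)},\chi_b^{*(j)},S_{ab}^{(i,j)}$ be those of the initial hierarchy. If $n\ge k$ then $$\frac{\tau^{(n,k)}}{\tau^{(0,0)}}=\Bigl((-1)^k\det\bigl(S_{ab}^{(i-1,j-1)}\bigr)_{i,j=1}^k\Bigr)^{-(n-k-1)}\,W_{n-k}\bigl[B_k,\dots,B_{n-1}\bigr],\qquad B_s=\det\begin{pmatrix}S_{ab}^{(i-1,j-1)}&\chi_a^{(i-1)}\\ S_{ab}^{(s,j-1)}&\chi_a^{(s)}\end{pmatrix}_{i,j=1,\dots,k},$$ and if $n\le k$ then $$\frac{\tau^{(n,k)}}{\tau^{(0,0)}}=\Bigl((-1)^n\det\bigl(S_{ab}^{(i-1,j-1)}\bigr)_{i,j=1}^n\Bigr)^{-(k-n-1)}\,W_{k-n}\bigl[B^*_n,\dots,B^*_{k-1}\bigr],\qquad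 B^*_s=\det\begin{pmatrix}S_{ab}^{(i-1,j-1)}&S_{ab}^{(i-1,s)}\\ \chi_b^{*(j-1)}&\chi_b^{*(s)}\end{pmatrix}_{i,j=1,\dots,n}.$$ The determinant raised to the power $-(|n-k|-1)$ is assumed invertible when this exponent is negative. -/

import Mathlib

/-! Binary Darboux–Bäcklund orbits of constrained KP hierarchies. -/

namespace KP

variable {K A : Type*} [Field K] [CommRing A] [Algebra K A]

/-! ### Functions of the KP times -/

/-- The derivations `∂/∂t_n`, `n ≥ 1`, of a `K`-algebra `A` of functions of the KP multi-time
`t = (t_1, t_2, …)`: a family of commuting `K`-linear derivations.  The variable `t_1` is the space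
variable `x`. -/
structure Times (K A : Type*) [Field K] [CommRing A] [Algebra K A] where
  d : ℕ+ → Derivation K A A
  comm : ∀ (i j : ℕ+) (f : A), d i (d j f) = d j (d i f)

/-! ### Pseudo-differential operators -/

/-- Formal pseudo-differential operators `∑_{i ≤ N} a_i D^i` with coefficients in `A` written on the
left, where `[D, f] = δ f`. -/
@[ext]
structure PsiDO (δ : Derivation K A A) where
  coeff : ℤ → A
  bounded : ∃ N : ℤ, ∀ i, N < i → coeff i = 0

namespace PsiDO

variable {δ : Derivation K A A}

/-- Multiplication by the generalized Leibniz rule `D^i f = ∑_{l ≥ 0} (i choose l) (δ^l f) D^{i-l}`,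
`i ∈ ℤ`:  the coefficient of `D^n` in `P R` is the (finite) sum of
`(i choose l) P_i δ^l (R_{n - i + l})` over all integers `i` and all `l ≥ 0`. -/
noncomputable instance : Mul (PsiDO δ) where
  mul P R :=
    { coeff := fun n => ∑ᶠ p : ℤ × ℕ,
        (Ring.choose p.1 p.2 : ℤ) • (P.coeff p.1 * δ^[p.2] (R.coeff (n - p.1 + p.2)))
      bounded := by
        obtain ⟨N, hN⟩ := P.bounded
        obtain ⟨M, hM⟩ := R.bounded
        refine ⟨N + M, fun n hn => ?_⟩
        have h0 : ∀ l : ℕ, δ^[l] (0 : A) = 0 := fun l => by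
          induction l with
          | zero => rfl
          | succ l ih => rw [Function.iterate_succ_apply', ih, map_zero]
        refine finsum_eq_zero_of_forall_eq_zero fun p => ?_
        by_cases h : N < p.1
        · rw [hN _ h, zero_mul, smul_zero]
        · rw [hM _ (by omega), h0, mul_zero, smul_zero] }

/-- The monomial `f D^n`. -/
def monomial (δ : Derivation K A A) (n : ℤ) (f : A) : PsiDO δ where
  coeff i := if i = n then f else 0
  bounded := ⟨n, fun _ hi => if_neg (ne_of_gt hi)⟩

/-- The operator of multiplication by `f`. -/
def C (δ : Derivation K A A) (f : A) : PsiDO δ := monomial δ 0 f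

/-- The power `D^n`, `n ∈ ℤ`. -/
def D (δ : Derivation K A A) (n : ℤ) : PsiDO δ := monomial δ n 1

/-- Powers `P^n`, `n ∈ ℕ`. -/
noncomputable def pow (P : PsiDO δ) : ℕ → PsiDO δ
  | 0 => C δ 1
  | n + 1 => pow P n * P

/-- The purely differential part `P_+ = ∑_{i ≥ 0} P_i D^i`. -/
def pos (P : PsiDO δ) : PsiDO δ where
  coeff i := if 0 ≤ i then P.coeff i else 0
  bounded := by
    obtain ⟨N, hN⟩ := P.bounded
    exact ⟨N, fun i hi => by simp [hN i hi]⟩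

/-- The residue: the coefficient of `D^{-1}`. -/
def res (P : PsiDO δ) : A := P.coeff (-1)

/-- The action `P_+(f) = ∑_{j ≥ 0} P_j δ^j f` of the differential part of `P` on a function. -/
noncomputable def act (P : PsiDO δ) (f : A) : A := ∑ᶠ j : ℕ, P.coeff j * δ^[j] f

/-- The action `(P^*)_+(g) = ∑_{j ≥ 0} (-δ)^j (P_j g)` of the differential part of the adjoint
operator `P^* = ∑_j (-D)^j P_j` on a function. -/
noncomputable def adjAct (P : PsiDO δ) (g : A) : A :=
  ∑ᶠ j : ℕ, (-1) ^ j * δ^[j] (P.coeff j * g)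

end PsiDO

open PsiDO

/-! ### The tau-function and the dressing operator -/

/-- `p_n(-[∂])` with `[∂] = (∂/∂t_1, (1/2) ∂/∂t_2, (1/3) ∂/∂t_3, …)` and the Schur polynomials
`∑_n λ^n p_n(s) = exp (∑_{l ≥ 1} λ^l s_l)`.  The recursion
`n p_n(-[∂]) = - ∑_{k=1}^n (∂/∂t_k) p_{n-k}(-[∂])` is the logarithmic `λ`-derivative of
`∑_n λ^n p_n(-[∂]) = exp (- ∑_{l ≥ 1} (λ^l / l) ∂/∂t_l)`. -/
noncomputable def schurNeg (t : Times K A) : ℕ → A → A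
  | 0, f => f
  | n + 1, f =>
      -(((n + 1 : ℕ) : K)⁻¹ • ∑ k : Fin (n + 1), t.d (k : ℕ).succPNat (schurNeg t (n - k) f))
  termination_by n => n
  decreasing_by omega

/-- The dressing operator `W = ∑_{n ≥ 0} (p_n(-[∂]) τ / τ) D^{-n}` of the tau-function `τ`. -/
noncomputable def dressing (t : Times K A) (τ : Aˣ) : PsiDO (t.d 1) where
  coeff i := if i ≤ 0 then (↑τ⁻¹ : A) * schurNeg t (-i).toNat τ else 0
  bounded := ⟨0, fun _ hi => if_neg (not_le.mpr hi)⟩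

/-! ### Constrained KP hierarchies -/

/-- The objects attached to a point of the space of constrained KP hierarchies with `m` pairs of
(adjoint) eigenfunctions: the Lax operator `L`, the functions `Φ_1, …, Φ_m` and `Ψ_1, …, Ψ_m` of its
pseudo-differential part, the tau-function, and the squared eigenfunction potentials `S(f, g)`.
`S` is bilinear over the constants; only its values on pairs of an eigenfunction and an adjoint
eigenfunction matter. -/
structure Hierarchy (t : Times K A) (m : ℕ) where
  L : PsiDO (t.d 1)
  Φ : Fin m → A
  Ψ : Fin m → A
  τ : Aˣ
  S : A →ₗ[K] A →ₗ[K] A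

namespace Hierarchy

variable {t : Times K A} {m : ℕ}

/-- `L(f) = L_+(f) + ∑_i Φ_i S(f, Ψ_i)`. -/
noncomputable def applyL (X : Hierarchy t m) (f : A) : A :=
  X.L.act f + ∑ i, X.Φ i * X.S f (X.Ψ i)

/-- `L^*(g) = (L^*)_+(g) - ∑_i Ψ_i S(Φ_i, g)`; here `(Φ_i D^{-1} Ψ_i)^* = -Ψ_i D^{-1} Φ_i`. -/
noncomputable def applyLStar (X : Hierarchy t m) (g : A) : A :=
  X.L.adjAct g - ∑ i, X.Ψ i * X.S (X.Φ i) g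

/-- `χ_c^{(i)} = L^i(Φ_c)`. -/
noncomputable def chi (X : Hierarchy t m) (c : Fin m) (i : ℕ) : A := X.applyL^[i] (X.Φ c)

/-- `χ_c^{*(j)} = (L^*)^j(Ψ_c)`. -/
noncomputable def chiStar (X : Hierarchy t m) (c : Fin m) (j : ℕ) : A := X.applyLStar^[j] (X.Ψ c)

/-- `S_{ab}^{(i,j)} = S(L^i(Φ_a), (L^*)^j(Ψ_b))`. -/
noncomputable def sep (X : Hierarchy t m) (a b : Fin m) (i j : ℕ) : A :=
  X.S (X.chi a i) (X.chiStar b j)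

/-- `X` is a constrained KP hierarchy `cKP_{r,m}` with tau-function `X.τ`; `Q` is the root
`L^{1/r} = D + O(D^{-1})` of its Lax operator. -/
structure IsCKP (X : Hierarchy t m) (r : ℕ+) (Q : PsiDO (t.d 1)) : Prop where
  root_top : ∀ i, 1 < i → Q.coeff i = 0
  root_one : Q.coeff 1 = 1
  root_zero : Q.coeff 0 = 0
  root_pow : Q.pow r = X.L
  /-- `L_- = ∑_c Φ_c D^{-1} Ψ_c`. -/
  negPart : ∀ i < 0, X.L.coeff i =
    ∑ c, (C (t.d 1) (X.Φ c) * D (t.d 1) (-1) * C (t.d 1) (X.Ψ c)).coeff i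
  /-- The Lax equations `∂L/∂t_n = [L^{n/r}_+, L]`. -/
  lax : ∀ (n : ℕ+) (i : ℤ), t.d n (X.L.coeff i) =
    ((Q.pow n).pos * X.L).coeff i - (X.L * (Q.pow n).pos).coeff i
  /-- The `Φ_c` are eigenfunctions: `∂Φ_c/∂t_n = L^{n/r}_+(Φ_c)`. -/
  eigen : ∀ (n : ℕ+) (c : Fin m), t.d n (X.Φ c) = (Q.pow n).act (X.Φ c)
  /-- The `Ψ_c` are adjoint eigenfunctions: `∂Ψ_c/∂t_n = -(L^*)^{n/r}_+(Ψ_c)`. -/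
  adjEigen : ∀ (n : ℕ+) (c : Fin m), t.d n (X.Ψ c) = -(Q.pow n).adjAct (X.Ψ c)
  /-- `L = W D^r W^{-1}` with the dressing operator `W` of the tau-function. -/
  dress : X.L * dressing t X.τ = dressing t X.τ * D (t.d 1) r
  /-- The Wilson–Sato equations `∂W/∂t_n = L^{n/r}_+ W - W D^n`. -/
  sato : ∀ (n : ℕ+) (i : ℤ), t.d n ((dressing t X.τ).coeff i) =
    ((Q.pow n).pos * dressing t X.τ).coeff i - (dressing t X.τ * D (t.d 1) n).coeff i

/-- `X.S` supplies squared eigenfunction potentials of the pairs `(L^i(Φ_c), (L^*)^j(Ψ_e))`.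
The defining equation `flow` fixes each of them up to an additive constant.  For the pair `(a, b)`
that generates the orbit, `byParts` says that the constants are chosen in such a way that
integration by parts produces no integration constants: both sides of `byParts` have the same
derivatives, so that the equation is a condition on the additive constants only. -/
structure IsSEP (X : Hierarchy t m) (r : ℕ+) (Q : PsiDO (t.d 1)) (a b : Fin m) : Prop where
  /-- `∂S(f, g)/∂t_n = Res (D^{-1} g L^{n/r}_+ f D^{-1})`. -/
  flow : ∀ (n : ℕ+) (c e : Fin m) (i j : ℕ), t.d n (X.sep c e i j) =
    (D (t.d 1) (-1) * C (t.d 1) (X.chiStar e j) * (Q.pow n).pos *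
      C (t.d 1) (X.chi c i) * D (t.d 1) (-1)).res
  /-- `S(L(f), g) - S(f, L^*(g)) = ∂S(f, g)/∂t_r + ∑_c S(f, Ψ_c) S(Φ_c, g)` for
  `f = L^i(Φ_a)`, `g = (L^*)^j(Ψ_b)`. -/
  byParts : ∀ i j : ℕ, X.sep a b (i + 1) j - X.sep a b i (j + 1) =
    t.d r (X.sep a b i j) + ∑ c, X.sep a c i 0 * X.sep c b 0 j

/-! ### Darboux–Bäcklund transformations -/

/-- The operator `u D^n u^{-1}`. -/
noncomputable def conjD (t : Times K A) (n : ℤ) (u : Aˣ) : PsiDO (t.d 1) :=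
  C (t.d 1) u * D (t.d 1) n * C (t.d 1) (↑u⁻¹ : A)

/-- `(u D u^{-1})(f) = u ∂_x (f / u)`. -/
def darboux (t : Times K A) (u : Aˣ) (f : A) : A := u * t.d 1 ((↑u⁻¹ : A) * f)

/-- `Y` is the Darboux–Bäcklund transform of `X` with respect to the invertible function
`φ = Φ_a`, with `T_a = φ D φ^{-1}`. -/
structure IsDB (a : Fin m) (φ : Aˣ) (X Y : Hierarchy t m) : Prop where
  unit_eq : (φ : A) = X.Φ a
  /-- `T_a L T_a^{-1}`. -/
  lax : Y.L = conjD t 1 φ * X.L * conjD t (-1) φ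
  /-- `T_a L(Φ_a)`. -/
  phi_self : Y.Φ a = darboux t φ (X.applyL (X.Φ a))
  phi : ∀ i, i ≠ a → Y.Φ i = darboux t φ (X.Φ i)
  psi_self : Y.Ψ a = (↑φ⁻¹ : A)
  /-- `(T_a^*)^{-1}(Ψ_i) = -S(Φ_a, Ψ_i) / Φ_a`. -/
  psi : ∀ i, i ≠ a → Y.Ψ i = -((↑φ⁻¹ : A) * X.S (X.Φ a) (X.Ψ i))
  tau : (Y.τ : A) = X.Φ a * X.τ
  /-- The potential of `T_a(f)` and `(T_a^*)^{-1}(g) = -S(Φ_a, g) / Φ_a` is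
  `S(f, g) - f S(Φ_a, g) / Φ_a`, whose `x`-derivative is the product of the two; no additive constant
  is introduced. -/
  sep : ∀ (c e : Fin m) (i j : ℕ),
    Y.S (darboux t φ (X.chi c i)) (-((↑φ⁻¹ : A) * X.S (X.Φ a) (X.chiStar e j))) =
      X.sep c e i j - X.chi c i * (↑φ⁻¹ : A) * X.S (X.Φ a) (X.chiStar e j)
  /-- The potential of `T_a(f)` and `1 / Φ_a` is `f / Φ_a`, up to a constant. -/
  sep_self : ∀ (c : Fin m) (i : ℕ), ∃ κ : K,
    Y.S (darboux t φ (X.chi c i)) (↑φ⁻¹ : A) = X.chi c i * (↑φ⁻¹ : A) + algebraMap K A κ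

/-- `Y` is the adjoint Darboux–Bäcklund transform of `X` with respect to the invertible function
`ψ = Ψ_b`, with `T_b = ψ D ψ^{-1}` and `(T_b^*)^{-1} = -ψ^{-1} D^{-1} ψ`. -/
structure IsAdjDB (b : Fin m) (ψ : Aˣ) (X Y : Hierarchy t m) : Prop where
  unit_eq : (ψ : A) = X.Ψ b
  /-- `(T_b^*)^{-1} L T_b^* = (ψ^{-1} D^{-1} ψ) L (ψ^{-1} D ψ)`. -/
  lax : Y.L = conjD t (-1) ψ⁻¹ * X.L * conjD t 1 ψ⁻¹
  phi_self : Y.Φ b = -(↑ψ⁻¹ : A)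
  /-- `(T_b^*)^{-1}(Φ_i) = -S(Φ_i, Ψ_b) / Ψ_b`. -/
  phi : ∀ i, i ≠ b → Y.Φ i = -((↑ψ⁻¹ : A) * X.S (X.Φ i) (X.Ψ b))
  /-- `T_b L^*(Ψ_b)`. -/
  psi_self : Y.Ψ b = darboux t ψ (X.applyLStar (X.Ψ b))
  psi : ∀ i, i ≠ b → Y.Ψ i = darboux t ψ (X.Ψ i)
  tau : (Y.τ : A) = X.Ψ b * X.τ
  /-- The potential of `(T_b^*)^{-1}(f) = -S(f, Ψ_b) / Ψ_b` and `T_b(g)` is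
  `S(f, g) - g S(f, Ψ_b) / Ψ_b`. -/
  sep : ∀ (c e : Fin m) (i j : ℕ),
    Y.S (-((↑ψ⁻¹ : A) * X.S (X.chi c i) (X.Ψ b))) (darboux t ψ (X.chiStar e j)) =
      X.sep c e i j - X.chiStar e j * (↑ψ⁻¹ : A) * X.S (X.chi c i) (X.Ψ b)
  /-- The potential of `-1 / Ψ_b` and `T_b(g)` is `-g / Ψ_b`, up to a constant. -/
  sep_self : ∀ (e : Fin m) (j : ℕ), ∃ κ : K,
    Y.S (-(↑ψ⁻¹ : A)) (darboux t ψ (X.chiStar e j)) =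
      -(X.chiStar e j * (↑ψ⁻¹ : A)) + algebraMap K A κ

/-- `Orbit a b X₀ n k X`: the hierarchy `X` arises from `X₀` by `n` Darboux–Bäcklund transformations
with respect to (the current) `Φ_a` and `k` adjoint ones with respect to (the current) `Ψ_b`, carried
out successively in some order. -/
inductive Orbit (a b : Fin m) (X₀ : Hierarchy t m) : ℕ → ℕ → Hierarchy t m → Prop
  | start : Orbit a b X₀ 0 0 X₀
  | db {n k : ℕ} {X Y : Hierarchy t m} (φ : Aˣ) (h : Orbit a b X₀ n k X) (hXY : IsDB a φ X Y) :
      Orbit a b X₀ (n + 1) k Y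
  | adj {n k : ℕ} {X Y : Hierarchy t m} (ψ : Aˣ) (h : Orbit a b X₀ n k X) (hXY : IsAdjDB b ψ X Y) :
      Orbit a b X₀ n (k + 1) Y

/-! ### The determinants -/

/-- The `k × k` matrix with entries `S_{ab}^{(i-1,j-1)}`, `i, j = 1, …, k`. -/
noncomputable def sepMatrix (X : Hierarchy t m) (a b : Fin m) (k : ℕ) : Matrix (Fin k) (Fin k) A :=
  Matrix.of fun i j => X.sep a b i j

/-- The bordered determinant with last column `χ_a^{(0)}, …, χ_a^{(k-1)}`, last row
`S_{ab}^{(s,0)}, …, S_{ab}^{(s,k-1)}` and corner `χ_a^{(s)}`. -/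
noncomputable def borderChi (X : Hierarchy t m) (a b : Fin m) (k s : ℕ) : A :=
  (Matrix.fromBlocks (X.sepMatrix a b k)
    (Matrix.of fun (i : Fin k) (_ : Unit) => X.chi a i)
    (Matrix.of fun (_ : Unit) (j : Fin k) => X.sep a b s j)
    (Matrix.of fun (_ : Unit) (_ : Unit) => X.chi a s)).det

/-- The bordered determinant with last column `S_{ab}^{(0,s)}, …, S_{ab}^{(n-1,s)}`, last row
`χ_b^{*(0)}, …, χ_b^{*(n-1)}` and corner `χ_b^{*(s)}`. -/
noncomputable def borderChiStar (X : Hierarchy t m) (a b : Fin m) (n s : ℕ) : A :=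
  (Matrix.fromBlocks (X.sepMatrix a b n)
    (Matrix.of fun (i : Fin n) (_ : Unit) => X.sep a b i s)
    (Matrix.of fun (_ : Unit) (j : Fin n) => X.chiStar b j)
    (Matrix.of fun (_ : Unit) (_ : Unit) => X.chiStar b s)).det

end Hierarchy

/-- The Wronskian determinant `W_p[f_1, …, f_p] = det (∂_x^{α-1} f_β)`. -/
def wronskian (t : Times K A) {p : ℕ} (f : Fin p → A) : A :=
  (Matrix.of fun α β : Fin p => (t.d 1)^[(α : ℕ)] (f β)).det

/-- Integer powers `x^e`; meaningful for `e < 0` only if `x` is invertible. -/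
noncomputable def intPow (x : A) : ℤ → A
  | .ofNat e => x ^ e
  | .negSucc e => Ring.inverse x ^ (e + 1)

end KP

namespace KP

/-! ### Associativity of the product of pseudo-differential operators -/

/-! The quotient of tau-functions is the product of the inverted functions, so only the family f_i =
`χ_a^{(i)}`, g_j = `χ_b^{*(j)}` and potentials S_{ij} with ∂S_{ij} = f_i g_j has to be followed. A
DB step with φ = f_0 and T = φDφ⁻¹ turns g_j into -S_{0j}/φ, f_i into T(f_{i+1}) and S_{ij} into
S_{i+1,j} - f_{i+1}S_{0j}/φ, up to a unitriangular change of the index i with coefficients in `K`.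
This change comes from the free constants in the potentials paired with 1/φ, and determinants do not
see it. An adjoint step is the same with f and g exchanged.

For this to hold all along the orbit, T must intertwine the actions of L up to a constant multiple
of T(L(Φ_a)), and its inverse adjoint must intertwine the actions of L^* exactly. The latter is
integration by parts, in which ∂S/∂t_r is the concomitant of L_+. Hence the invariant `IsCoherent`:
the x- and t_r-derivatives of f, g, S together with exact integration by parts. It holds initially
(`IsCKP.isCoherent`, from the Lax equation for t_r) and survives both transformations
(`IsDB.isCoherent`, `IsAdjDB.isCoherent`). The calculations are identities in the associative ring
of pseudo-differential operators, because P_+(f) = Res(P f D⁻¹) and (P^*)_+(g) = Res(D⁻¹ g P).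

The rest is linear algebra over a differential ring (`SepData`). For k ≤ n the product of inverted
functions is, up to sign, the determinant `SepData.mat` with rows S_{ij} (j < k) and ∂^l f_i (l < n
- k); for n ≤ k the data are swapped. This is proved by induction, stripping the first
transformation from the chain: pivoting on f_0 = φ lowers the size (`IsStep.det_mat_succ`), and
∂S_{0j} = φ g_j trades a row of potentials for a row of functions (`IsStep.det_swap_mat`). Finally
`det_border` converts the determinant into a Wronskian: a bordered determinant is det S times a
Schur complement, and since ∂S = f gᵀ has rank one, differentiating Schur complements is triangular
(`deriv_schurCompl`). -/

open Finset in
theorem iterate_derivation_mul {K A : Type*} [Field K] [CommRing A] [Algebra K A]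
    (δ : Derivation K A A) (n : ℕ) (a b : A) :
    δ^[n] (a * b) =
      ∑ ij ∈ antidiagonal n, (n.choose ij.1 : A) * (δ^[ij.1] a * δ^[ij.2] b) := by
  induction n with
  | zero => simp
  | succ n ih =>
    rw [Finset.sum_antidiagonal_choose_succ_mul (fun i j => δ^[i] a * δ^[j] b) n]
    simp only [Function.iterate_succ_apply', ih, map_sum, Derivation.leibniz, smul_eq_mul,
      Derivation.map_natCast, mul_zero, add_zero, mul_add, Finset.sum_add_distrib]
    refine congrArg₂ (· + ·) rfl (Finset.sum_congr rfl fun ij hij => ?_)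
    rw [Nat.choose_symm_of_eq_add (Finset.HasAntidiagonal.mem_antidiagonal.1 hij).symm]
    ring

-- Allows summation by total order of differentiation, the only combination of the two orders on
-- which the coefficient of the third factor depends.
open Finset in
theorem finsum_prod_eq_finsum_antidiagonal {A : Type*} [AddCommMonoid A] (g : ℕ × ℕ → A)
    (hg : g.support.Finite) :
    ∑ᶠ p, g p = ∑ᶠ w, ∑ p ∈ Finset.HasAntidiagonal.antidiagonal w, g p := by
  classical
  have hsub : (fun w => ∑ p ∈ Finset.HasAntidiagonal.antidiagonal w, g p).support ⊆
      ((hg.toFinset.image fun p => p.1 + p.2 : Finset ℕ) : Set ℕ) := by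
    intro w hw
    obtain ⟨p, hp, hgp⟩ := Finset.exists_ne_zero_of_sum_ne_zero hw
    rw [Finset.coe_image]
    exact ⟨p, by simpa using hgp, Finset.HasAntidiagonal.mem_antidiagonal.1 hp⟩
  rw [finsum_eq_finsetSum_of_support_subset _ hsub,
    finsum_eq_finsetSum_of_support_subset (s := hg.toFinset) _ (by simp),
    ← Finset.sum_fiberwise_of_maps_to (g := fun p : ℕ × ℕ => p.1 + p.2)
      (t := hg.toFinset.image fun p => p.1 + p.2)
      (fun p hp => Finset.mem_image_of_mem _ hp)]
  refine Finset.sum_congr rfl fun w _ => ?_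
  refine Finset.sum_subset_zero_on_sdiff (fun p hp => ?_) (fun p hp => ?_) fun _ _ => rfl
  · simpa using (Finset.mem_filter.1 hp).2
  · by_contra h
    simp only [Finset.mem_sdiff, Finset.HasAntidiagonal.mem_antidiagonal, Finset.mem_filter] at hp
    exact hp.2 ⟨by simpa using h, hp.1⟩

variable {K A : Type*} [Field K] [CommRing A] [Algebra K A] {δ : Derivation K A A}

-- Compares the two bracketings of D^j b D^k c at total order `w`. The left side opens up by the
-- Leibniz rule, the right side by Vandermonde's identity, and the terms agree because C(j, s+x)
-- C(s+x, s) = C(j, s) C(j-s, x).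
open Finset in
theorem sum_antidiagonal_choose_iterate (j k : ℤ) (b c : A) (w : ℕ) :
    ∑ p ∈ antidiagonal w, ((Ring.choose j p.1 : ℤ) : A) * ((Ring.choose k p.2 : ℤ) : A) *
        δ^[p.1] (b * δ^[p.2] c) =
      ∑ p ∈ antidiagonal w, ((Ring.choose j p.1 : ℤ) : A) *
        ((Ring.choose (j - p.1 + k) p.2 : ℤ) : A) * (δ^[p.1] b * δ^[p.2] c) := by
  have hch : ∀ s x : ℕ, (Ring.choose j (s + x) : ℤ) * ((s + x).choose s : ℕ) =
      Ring.choose j s * Ring.choose (j - s) x := by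
    intro s x
    have := Ring.choose_smul_choose j (Nat.le_add_right s x)
    rw [Nat.add_sub_cancel_left, nsmul_eq_mul] at this
    rw [mul_comm, this]
  have hadd : ∀ (s l : ℕ), Ring.choose (j - s + k) l =
      ∑ p ∈ antidiagonal l, Ring.choose (j - s) p.1 * Ring.choose k p.2 :=
    fun s l => Ring.add_choose_eq l (mul_comm _ _)
  simp only [iterate_derivation_mul, hadd, Int.cast_sum, Finset.mul_sum, Finset.sum_mul]
  rw [Finset.sum_sigma', Finset.sum_sigma']
  -- The order u = s + x splits into s derivatives falling on b and x falling on δ^v c, which then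
  -- carries x + v.
  refine Finset.sum_nbij' (fun x => ⟨(x.2.1, x.2.2 + x.1.2), (x.2.2, x.1.2)⟩)
    (fun x => ⟨(x.1.1 + x.2.1, x.2.2), (x.1.1, x.2.1)⟩) ?_ ?_ ?_ ?_ ?_
  · rintro ⟨⟨u, v⟩, ⟨s, x⟩⟩ h
    simp only [mem_sigma, Finset.HasAntidiagonal.mem_antidiagonal] at h ⊢
    refine ⟨?_, ?_⟩ <;> first | trivial | omega
  · rintro ⟨⟨u, v⟩, ⟨s, x⟩⟩ h
    simp only [mem_sigma, Finset.HasAntidiagonal.mem_antidiagonal] at h ⊢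
    refine ⟨?_, ?_⟩ <;> first | trivial | omega
  · rintro ⟨⟨u, v⟩, ⟨s, x⟩⟩ h
    simp only [mem_sigma, Finset.HasAntidiagonal.mem_antidiagonal] at h
    obtain ⟨h1, rfl⟩ := h
    rfl
  · rintro ⟨⟨u, v⟩, ⟨s, x⟩⟩ h
    simp only [mem_sigma, Finset.HasAntidiagonal.mem_antidiagonal] at h
    obtain ⟨h1, rfl⟩ := h
    rfl
  · rintro ⟨⟨u, v⟩, ⟨s, x⟩⟩ h
    simp only [mem_sigma, Finset.HasAntidiagonal.mem_antidiagonal] at h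
    obtain ⟨h1, rfl⟩ := h
    have := congrArg (fun z : ℤ => (z : A)) (hch s x)
    push_cast at this ⊢
    rw [← Function.iterate_add_apply]
    linear_combination ((Ring.choose k v : ℤ) : A) * (δ^[s] b * δ^[x + v] c) * this

namespace PsiDO

theorem coeff_mul (P R : PsiDO δ) (n : ℤ) : (P * R).coeff n =
    ∑ᶠ p : ℤ × ℕ, ((Ring.choose p.1 p.2 : ℤ) : A) *
      (P.coeff p.1 * δ^[p.2] (R.coeff (n - p.1 + p.2))) := by
  simp_rw [← zsmul_eq_mul]
  rfl

/-- The bounds i ≤ N and n - i + l ≤ M leave finitely many (i, l). Without finiteness a `finsum`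
defaults to 0 and could not be rearranged. -/
theorem mul_support_finite (P R : PsiDO δ) (n : ℤ) :
    {p : ℤ × ℕ | P.coeff p.1 ≠ 0 ∧ R.coeff (n - p.1 + p.2) ≠ 0}.Finite := by
  obtain ⟨N, hN⟩ := P.bounded
  obtain ⟨M, hM⟩ := R.bounded
  refine ((Set.finite_Icc (n - M) N).prod (Set.finite_Iic (M - n + N).toNat)).subset ?_
  rintro ⟨i, l⟩ ⟨h1, h2⟩
  have h1' : i ≤ N := not_lt.1 fun h => h1 (hN _ h)
  have h2' : n - i + l ≤ M := not_lt.1 fun h => h2 (hM _ h)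
  simp only [Set.mem_prod, Set.mem_Icc, Set.mem_Iic]
  omega

theorem mul_term_support (P R : PsiDO δ) (n : ℤ) :
    (Function.support fun p : ℤ × ℕ => ((Ring.choose p.1 p.2 : ℤ) : A) *
      (P.coeff p.1 * δ^[p.2] (R.coeff (n - p.1 + p.2)))).Finite := by
  refine (mul_support_finite P R n).subset fun p hp => ⟨fun h => hp ?_, fun h => hp ?_⟩
  · simp [h]
  · simp [h]

/-- The three-fold product, expanded along `D^j b D^k c`. -/
noncomputable def tripleCoeff (P Q R : PsiDO δ) (n : ℤ) (p : ℤ × ℤ) (q : ℕ × ℕ) : A :=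
  P.coeff p.1 * (((Ring.choose p.1 q.1 : ℤ) : A) * ((Ring.choose (p.1 - q.1 + p.2) q.2 : ℤ) : A) *
    (δ^[q.1] (Q.coeff p.2) * δ^[q.2] (R.coeff (n - p.1 - p.2 + q.1 + q.2))))

theorem triple_support_finite (P Q R : PsiDO δ) (n : ℤ) :
    {x : (ℤ × ℤ) × (ℕ × ℕ) | P.coeff x.1.1 ≠ 0 ∧ Q.coeff x.1.2 ≠ 0 ∧
      R.coeff (n - x.1.1 - x.1.2 + x.2.1 + x.2.2) ≠ 0}.Finite := by
  obtain ⟨N, hN⟩ := P.bounded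
  obtain ⟨M, hM⟩ := Q.bounded
  obtain ⟨L, hL⟩ := R.bounded
  refine (((Set.finite_Icc (n - L - M) N).prod (Set.finite_Icc (n - L - N) M)).prod
    ((Set.finite_Iic (L - n + N + M).toNat).prod
      (Set.finite_Iic (L - n + N + M).toNat))).subset ?_
  rintro ⟨⟨j, k⟩, ⟨s, l⟩⟩ ⟨h1, h2, h3⟩
  have h1' : j ≤ N := not_lt.1 fun h => h1 (hN _ h)
  have h2' : k ≤ M := not_lt.1 fun h => h2 (hM _ h)
  have h3' : n - j - k + s + l ≤ L := not_lt.1 fun h => h3 (hL _ h)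
  simp only [Set.mem_prod, Set.mem_Icc, Set.mem_Iic]
  omega

theorem triple_term_support (P Q R : PsiDO δ) (n : ℤ) :
    (Function.support fun x : (ℤ × ℤ) × (ℕ × ℕ) => tripleCoeff P Q R n x.1 x.2).Finite := by
  refine (triple_support_finite P Q R n).subset
    fun p hp => ⟨fun h => hp ?_, fun h => hp ?_, fun h => hp ?_⟩
  · simp [tripleCoeff, h]
  · simp [tripleCoeff, h]
  · simp [tripleCoeff, h]

/-- Reindexing `(i, l), (j, s)` with `i = j + k - s`. -/
def tripleEquivLeft : (ℤ × ℕ) × (ℤ × ℕ) ≃ (ℤ × ℤ) × (ℕ × ℕ) where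
  toFun x := ((x.2.1, x.1.1 - x.2.1 + x.2.2), (x.2.2, x.1.2))
  invFun y := ((y.1.1 - y.2.1 + y.1.2, y.2.2), (y.1.1, y.2.1))
  left_inv := by
    rintro ⟨⟨i, l⟩, ⟨j, s⟩⟩
    have : j - (s : ℤ) + (i - j + s) = i := by ring
    simp [this]
  right_inv := by
    rintro ⟨⟨j, k⟩, ⟨s, l⟩⟩
    have : j - (s : ℤ) + k - j + s = k := by ring
    simp [this]

/-- Reindexing `(j, u), (k, v)`. -/
def tripleEquivRight : (ℤ × ℕ) × (ℤ × ℕ) ≃ (ℤ × ℤ) × (ℕ × ℕ) where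
  toFun x := ((x.1.1, x.2.1), (x.1.2, x.2.2))
  invFun y := ((y.1.1, y.2.1), (y.1.2, y.2.2))
  left_inv _ := rfl
  right_inv _ := rfl

theorem coeff_mul_mul_left (P Q R : PsiDO δ) (n : ℤ) : ((P * Q) * R).coeff n =
    ∑ᶠ x : (ℤ × ℤ) × (ℕ × ℕ), tripleCoeff P Q R n x.1 x.2 := by
  rw [← finsum_comp_equiv tripleEquivLeft, finsum_curry, coeff_mul]
  swap
  · exact (triple_term_support P Q R n).preimage tripleEquivLeft.injective.injOn
  refine finsum_congr fun p => ?_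
  rw [coeff_mul, finsum_mul' _ _ (mul_term_support P Q p.1), mul_finsum']
  swap
  · exact (mul_term_support P Q p.1).subset fun q hq h => hq (by simp [h])
  refine finsum_congr fun q => ?_
  have e1 : q.1 - (q.2 : ℤ) + (p.1 - q.1 + q.2) = p.1 := by ring
  have e2 : n - q.1 - (p.1 - q.1 + (q.2 : ℤ)) + q.2 + p.2 = n - p.1 + p.2 := by ring
  simp only [tripleCoeff, tripleEquivLeft, Equiv.coe_fn_mk, e1, e2]
  ring

theorem coeff_mul_mul_right (P Q R : PsiDO δ) (n : ℤ) : (P * (Q * R)).coeff n =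
    ∑ᶠ x : (ℤ × ℤ) × (ℕ × ℕ), P.coeff x.1.1 * (((Ring.choose x.1.1 x.2.1 : ℤ) : A) *
      ((Ring.choose x.1.2 x.2.2 : ℤ) : A) * δ^[x.2.1] (Q.coeff x.1.2 *
        δ^[x.2.2] (R.coeff (n - x.1.1 - x.1.2 + x.2.1 + x.2.2)))) := by
  rw [← finsum_comp_equiv tripleEquivRight, finsum_curry, coeff_mul]
  swap
  · refine ((triple_support_finite P Q R n).preimage
      tripleEquivRight.injective.injOn).subset
      fun p hp => ⟨fun h => hp ?_, fun h => hp ?_, fun h => hp ?_⟩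
    · simp [h]
    · simp [h]
    · simp [h]
  refine finsum_congr fun p => ?_
  have hit : ∀ x, δ^[p.2] x = ((δ : A →ₗ[K] A) ^ p.2).toAddMonoidHom x := fun x => by
    simp [Module.End.pow_apply]
  rw [coeff_mul, hit, AddMonoidHom.map_finsum _ (mul_term_support Q R _), mul_finsum', mul_finsum']
  rotate_left
  · exact (mul_term_support Q R (n - p.1 + p.2)).subset fun q hq h =>
      hq (by simp only at h; simp only [h, map_zero, mul_zero])
  · exact (mul_term_support Q R (n - p.1 + p.2)).subset fun q hq h =>
      hq (by simp only at h; simp only [h, map_zero])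
  refine finsum_congr fun q => ?_
  have e2 : n - p.1 - q.1 + (p.2 : ℤ) + q.2 = n - p.1 + p.2 - q.1 + q.2 := by ring
  rw [← hit]
  have h3 : δ^[p.2] (((Ring.choose q.1 q.2 : ℤ) : A) *
      (Q.coeff q.1 * δ^[q.2] (R.coeff (n - p.1 + p.2 - q.1 + q.2)))) =
      ((Ring.choose q.1 q.2 : ℤ) : A) * δ^[p.2]
      (Q.coeff q.1 * δ^[q.2] (R.coeff (n - p.1 + p.2 - q.1 + q.2))) := by
    rw [hit, hit, ← zsmul_eq_mul, map_zsmul, zsmul_eq_mul]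
  simp only [tripleEquivRight, Equiv.coe_fn_mk, e2, h3]
  ring

theorem mul_assoc' (P Q R : PsiDO δ) : P * Q * R = P * (Q * R) := by
  refine PsiDO.ext (funext fun n => ?_)
  rw [coeff_mul_mul_left, coeff_mul_mul_right, finsum_curry _ (triple_term_support P Q R n)]
  have hfin : (Function.support fun x : (ℤ × ℤ) × (ℕ × ℕ) =>
      P.coeff x.1.1 * (((Ring.choose x.1.1 x.2.1 : ℤ) : A) *
      ((Ring.choose x.1.2 x.2.2 : ℤ) : A) * δ^[x.2.1] (Q.coeff x.1.2 *
        δ^[x.2.2] (R.coeff (n - x.1.1 - x.1.2 + x.2.1 + x.2.2))))).Finite := by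
    refine (triple_support_finite P Q R n).subset
      fun p hp => ⟨fun h => hp ?_, fun h => hp ?_, fun h => hp ?_⟩
    · simp [h]
    · simp [h]
    · simp [h]
  rw [finsum_curry _ hfin]
  refine finsum_congr fun p => ?_
  rw [finsum_prod_eq_finsum_antidiagonal _
      (hfin.preimage (f := fun q => (p, q)) (Prod.mk_right_injective p).injOn),
    finsum_prod_eq_finsum_antidiagonal _ ((triple_term_support P Q R n).preimage
      (f := fun q => (p, q)) (Prod.mk_right_injective p).injOn)]
  refine finsum_congr fun w => ?_
  simp only [tripleCoeff, ← Finset.mul_sum]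
  congr 1
  have e : ∀ q ∈ Finset.HasAntidiagonal.antidiagonal w,
      n - p.1 - p.2 + (q.1 : ℤ) + q.2 = n - p.1 - p.2 + w := by
    intro q hq
    rw [← Finset.HasAntidiagonal.mem_antidiagonal.1 hq]
    push_cast
    ring
  have := sum_antidiagonal_choose_iterate (δ := δ) p.1 p.2 (Q.coeff p.2)
    (R.coeff (n - p.1 - p.2 + w)) w
  refine (Finset.sum_congr rfl fun q hq => by rw [e q hq]).trans (this.symm.trans ?_)
  exact Finset.sum_congr rfl fun q hq => by rw [e q hq]

end PsiDO

end KP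

namespace KP

/-! ### The ring of pseudo-differential operators, residues and actions -/

variable {K A : Type*} [Field K] [CommRing A] [Algebra K A] {δ : Derivation K A A}

namespace PsiDO

noncomputable instance : Zero (PsiDO δ) := ⟨⟨fun _ => 0, 0, fun _ _ => rfl⟩⟩

noncomputable instance : One (PsiDO δ) := ⟨C δ 1⟩

noncomputable instance : Add (PsiDO δ) :=
  ⟨fun P R => ⟨fun n => P.coeff n + R.coeff n, by
    obtain ⟨N, hN⟩ := P.bounded
    obtain ⟨M, hM⟩ := R.bounded
    exact ⟨max N M, fun i hi => by
      rw [hN i (lt_of_le_of_lt (le_max_left _ _) hi), hM i (lt_of_le_of_lt (le_max_right _ _) hi),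
        add_zero]⟩⟩⟩

noncomputable instance : Neg (PsiDO δ) :=
  ⟨fun P => ⟨fun n => -P.coeff n, by
    obtain ⟨N, hN⟩ := P.bounded
    exact ⟨N, fun i hi => by rw [hN i hi, neg_zero]⟩⟩⟩

@[simp] theorem coeff_zero (n : ℤ) : (0 : PsiDO δ).coeff n = 0 := rfl

@[simp] theorem coeff_add (P R : PsiDO δ) (n : ℤ) :
    (P + R).coeff n = P.coeff n + R.coeff n := rfl

@[simp] theorem coeff_neg (P : PsiDO δ) (n : ℤ) : (-P).coeff n = -P.coeff n := rfl

theorem coeff_monomial (m n : ℤ) (f : A) :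
    (monomial δ m f).coeff n = if n = m then f else 0 := rfl

theorem ext_coeff {P R : PsiDO δ} (h : ∀ n, P.coeff n = R.coeff n) : P = R :=
  PsiDO.ext (funext h)

/-- The coefficients of `f D^m R`. -/
theorem coeff_monomial_mul (m : ℤ) (f : A) (R : PsiDO δ) (n : ℤ) :
    (monomial δ m f * R).coeff n =
      ∑ᶠ l : ℕ, ((Ring.choose m l : ℤ) : A) * (f * δ^[l] (R.coeff (n - m + l))) := by
  rw [coeff_mul, finsum_curry _ (mul_term_support _ R n), finsum_eq_single _ m]
  · exact finsum_congr fun l => by simp [coeff_monomial]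
  · intro i hi
    exact finsum_eq_zero_of_forall_eq_zero fun l => by simp [coeff_monomial, hi]

/-- The coefficients of `P (f D^m)`. -/
theorem coeff_mul_monomial (P : PsiDO δ) (m : ℤ) (f : A) (n : ℤ) :
    (P * monomial δ m f).coeff n =
      ∑ᶠ l : ℕ, ((Ring.choose (n - m + l) l : ℤ) : A) * (P.coeff (n - m + l) * δ^[l] f) := by
  -- The first coordinate becomes the offset from the only index at which the coefficient of f D^m
  -- is nonzero, so only offset 0 contributes.
  let e : ℤ × ℕ ≃ ℤ × ℕ :=
    { toFun := fun p => (n - m + p.2 + p.1, p.2)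
      invFun := fun p => (p.1 - (n - m + p.2), p.2)
      left_inv := fun p => by simp
      right_inv := fun p => by simp }
  rw [coeff_mul, ← finsum_comp_equiv e, finsum_curry, finsum_eq_single _ 0]
  · refine finsum_congr fun l => ?_
    have h : n - (n - m + (l : ℤ)) + l = m := by ring
    simp only [e, Equiv.coe_fn_mk, add_zero, h, coeff_monomial, if_true]
  · intro x hx
    refine finsum_eq_zero_of_forall_eq_zero fun l => ?_
    have h : n - (n - m + (l : ℤ) + x) + l ≠ m := fun h => hx (by linarith)
    simp only [e, Equiv.coe_fn_mk, coeff_monomial, if_neg h, iterate_map_zero, mul_zero]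
  · exact (mul_term_support P (monomial δ m f) n).preimage e.injective.injOn

noncomputable instance : Distrib (PsiDO δ) where
  left_distrib P Q R := by
    refine ext_coeff fun n => ?_
    rw [coeff_add, coeff_mul, coeff_mul, coeff_mul,
      ← finsum_add_distrib (mul_term_support P Q n) (mul_term_support P R n)]
    refine finsum_congr fun p => ?_
    rw [coeff_add, iterate_map_add]
    ring
  right_distrib P Q R := by
    refine ext_coeff fun n => ?_
    rw [coeff_add, coeff_mul, coeff_mul, coeff_mul,
      ← finsum_add_distrib (mul_term_support P R n) (mul_term_support Q R n)]
    refine finsum_congr fun p => ?_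
    rw [coeff_add]
    ring

/-- Multiplication by a function from the left. -/
@[simp] theorem coeff_C_mul (f : A) (R : PsiDO δ) (n : ℤ) :
    (C δ f * R).coeff n = f * R.coeff n := by
  rw [C, coeff_monomial_mul, finsum_eq_single _ 0]
  · simp
  · intro l hl
    rw [Ring.choose_zero_pos ℤ (Nat.pos_of_ne_zero hl)]
    simp

@[simp] theorem coeff_mul_D (P : PsiDO δ) (m n : ℤ) : (P * D δ m).coeff n = P.coeff (n - m) := by
  rw [D, coeff_mul_monomial, finsum_eq_single _ 0]
  · simp
  · intro l hl
    obtain ⟨l, rfl⟩ := Nat.exists_eq_succ_of_ne_zero hl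
    rw [Function.iterate_succ_apply, Derivation.map_one_eq_zero, iterate_map_zero, mul_zero,
      mul_zero]

theorem coeff_D_one_mul (P : PsiDO δ) (n : ℤ) :
    (D δ 1 * P).coeff n = P.coeff (n - 1) + δ (P.coeff n) := by
  rw [D, coeff_monomial_mul, finsum_eq_finsetSum_of_support_subset (s := Finset.range 2)]
  · simp [Finset.sum_range_succ]
  · intro l hl
    rw [Finset.coe_range, Set.mem_Iio]
    by_contra h
    refine hl ?_
    have : (Ring.choose (1 : ℤ) l) = 0 := by
      have := Ring.choose_natCast (R := ℤ) 1 l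
      rw [Nat.cast_one] at this
      rw [this, Nat.choose_eq_zero_of_lt (by omega), Nat.cast_zero]
    simp [this]

noncomputable instance : Ring (PsiDO δ) where
  add_assoc P Q R := ext_coeff fun n => add_assoc _ _ _
  zero_add P := ext_coeff fun n => zero_add _
  add_zero P := ext_coeff fun n => add_zero _
  add_comm P Q := ext_coeff fun n => add_comm _ _
  neg_add_cancel P := ext_coeff fun n => neg_add_cancel _
  nsmul := nsmulRec
  zsmul := zsmulRec
  mul_assoc := mul_assoc'
  left_distrib := left_distrib
  right_distrib := right_distrib
  zero_mul P := ext_coeff fun n => by simp [coeff_mul]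
  mul_zero P := ext_coeff fun n => by simp [coeff_mul]
  one_mul P := ext_coeff fun n => by
    rw [show (1 : PsiDO δ) = C δ 1 from rfl, coeff_C_mul, one_mul]
  mul_one P := ext_coeff fun n => by
    rw [show (1 : PsiDO δ) = D δ 0 from rfl, coeff_mul_D, sub_zero]

@[simp] theorem coeff_sub (P R : PsiDO δ) (n : ℤ) :
    (P - R).coeff n = P.coeff n - R.coeff n := by
  rw [sub_eq_add_neg, coeff_add, coeff_neg, sub_eq_add_neg]

theorem coeff_C (f : A) (n : ℤ) : (C δ f).coeff n = if n = 0 then f else 0 := rfl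

@[simp] theorem C_one : C δ (1 : A) = 1 := rfl

theorem C_add (f g : A) : C δ (f + g) = C δ f + C δ g :=
  ext_coeff fun n => by by_cases h : n = 0 <;> simp [coeff_C, h]

theorem C_neg (f : A) : C δ (-f) = -C δ f :=
  ext_coeff fun n => by by_cases h : n = 0 <;> simp [coeff_C, h]

theorem C_mul (f g : A) : C δ (f * g) = C δ f * C δ g :=
  ext_coeff fun n => by by_cases h : n = 0 <;> simp [coeff_C, h]

theorem coeff_D (m n : ℤ) : (D δ m).coeff n = if n = m then 1 else 0 := rfl

theorem D_mul_D (m n : ℤ) : D δ m * D δ n = D δ (m + n) :=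
  ext_coeff fun k => by simp [coeff_D, sub_eq_iff_eq_add]

@[simp] theorem D_one_mul_D_neg_one : D δ 1 * D δ (-1) = 1 := by rw [D_mul_D]; rfl

@[simp] theorem D_neg_one_mul_D_one : D δ (-1) * D δ 1 = 1 := by rw [D_mul_D]; rfl

theorem D_one_mul_C (f : A) : D δ 1 * C δ f = C δ f * D δ 1 + C δ (δ f) :=
  ext_coeff fun n => by
    rw [coeff_D_one_mul, coeff_add, coeff_mul_D]
    by_cases h : n = 0 <;> simp [coeff_C, h]

/-- Integration by parts: `D^{-1} u' D^{-1} = u D^{-1} - D^{-1} u`. -/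
theorem D_neg_one_mul_C_mul_D_neg_one (u : A) :
    D δ (-1) * C δ (δ u) * D δ (-1) = C δ u * D δ (-1) - D δ (-1) * C δ u := by
  have h : C δ (δ u) = D δ 1 * C δ u - C δ u * D δ 1 := by rw [D_one_mul_C]; abel
  rw [h, mul_sub, sub_mul, ← mul_assoc, D_neg_one_mul_D_one, one_mul, mul_assoc, mul_assoc,
    D_one_mul_D_neg_one, mul_one]

theorem res_add (P R : PsiDO δ) : (P + R).res = P.res + R.res := rfl

theorem res_sub (P R : PsiDO δ) : (P - R).res = P.res - R.res := coeff_sub _ _ _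

theorem res_neg (P : PsiDO δ) : (-P).res = -P.res := rfl

theorem res_C_mul (f : A) (P : PsiDO δ) : (C δ f * P).res = f * P.res := coeff_C_mul _ _ _

/-- The corrections P_{l-1} δ^l f with l ≥ 1 carry the factor C(l-1, l) = 0. -/
theorem res_mul_C (P : PsiDO δ) (f : A) : (P * C δ f).res = P.res * f := by
  rw [res, C, coeff_mul_monomial, finsum_eq_single _ 0]
  · simp [res]
  · intro l hl
    obtain ⟨l, rfl⟩ := Nat.exists_eq_succ_of_ne_zero hl
    have e : (-1 - 0 + ((l + 1 : ℕ) : ℤ)) = (l : ℕ) := by push_cast; ring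
    rw [e, Ring.choose_natCast, Nat.choose_eq_zero_of_lt (Nat.lt_succ_self l)]
    simp

theorem res_D_one_mul (P : PsiDO δ) : (D δ 1 * P).res = P.coeff (-2) + δ P.res :=
  coeff_D_one_mul _ _

/-- In the residue of P f D⁻¹ each P_l meets δ^l f with coefficient C(l, l) = 1. Writing actions as
residues lets associativity of operators do the work of every later formula. -/
theorem act_eq_res (P : PsiDO δ) (f : A) : P.act f = (P * C δ f * D δ (-1)).res := by
  rw [res, coeff_mul_D, C, coeff_mul_monomial, act]
  refine finsum_congr fun l => ?_
  have e : (-1 - -1 - 0 + (l : ℤ)) = (l : ℕ) := by ring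
  rw [e, Ring.choose_natCast, Nat.choose_self]
  simp

/-- The signs of the adjoint are the binomials C(-1, l) = (-1)^l in the expansion of D⁻¹. -/
theorem adjAct_eq_res (P : PsiDO δ) (g : A) : P.adjAct g = (D δ (-1) * C δ g * P).res := by
  rw [mul_assoc, res, D, coeff_monomial_mul, adjAct]
  refine finsum_congr fun l => ?_
  have e : (Ring.choose (-1 : ℤ) l : ℤ) = (-1) ^ l := by
    have h := Ring.choose_neg (1 : ℤ) l
    have h2 : Ring.choose ((1 : ℤ) + l - 1) l = 1 := by
      rw [add_sub_cancel_left, Ring.choose_natCast, Nat.choose_self, Nat.cast_one]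
    rw [h, h2]
    simp [Int.negOnePow_def, Units.smul_def]
  rw [e, coeff_C_mul, mul_comm g]
  simp

theorem coeff_mul_eq_zero {P R : PsiDO δ} {N M n : ℤ} (hP : ∀ i, N < i → P.coeff i = 0)
    (hR : ∀ i, M < i → R.coeff i = 0) (hn : N + M < n) : (P * R).coeff n = 0 := by
  rw [coeff_mul]
  refine finsum_eq_zero_of_forall_eq_zero fun p => ?_
  by_cases h : N < p.1
  · rw [hP _ h, zero_mul, mul_zero]
  · rw [hR _ (by omega), iterate_map_zero, mul_zero, mul_zero]

end PsiDO

end KP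

namespace KP

/-! ### Conjugation by `u D u⁻¹` -/

variable {K A : Type*} [Field K] [CommRing A] [Algebra K A]

namespace PsiDO

variable {δ : Derivation K A A}

/-- The bilinear concomitant `Res (D^{-1} g P f D^{-1})` of `P_+`. -/
noncomputable def concomitant (P : PsiDO δ) (f g : A) : A :=
  (D δ (-1) * C δ g * P * C δ f * D δ (-1)).res

theorem res_mul_C_mul_D_one (Z : PsiDO δ) (v : A) :
    (Z * C δ v * D δ 1).res = Z.coeff (-2) * v - Z.res * δ v := by
  have h : Z * C δ v * D δ 1 = Z * D δ 1 * C δ v - Z * C δ (δ v) := by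
    have := D_one_mul_C (δ := δ) v
    rw [mul_assoc, mul_assoc Z, this, mul_add, add_sub_cancel_right]
  rw [h, res_sub, res_mul_C, res_mul_C]
  congr 2
  exact coeff_mul_D _ _ _

end PsiDO

open PsiDO

namespace Hierarchy

variable {t : Times K A}

local notation "∂" => D (t.d 1) 1
local notation "∂⁻¹" => D (t.d 1) (-1)
local notation "𝐜" => C (t.d 1)

theorem C_inv_mul_unit (u : Aˣ) : 𝐜 (↑u⁻¹ : A) * 𝐜 (u : A) = 1 := by
  rw [← C_mul, Units.inv_mul, C_one]

theorem darboux_self (u : Aˣ) : darboux t u (u : A) = 0 := by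
  rw [darboux, Units.inv_mul, Derivation.map_one_eq_zero, mul_zero]

theorem darboux_add (u : Aˣ) (f g : A) : darboux t u (f + g) = darboux t u f + darboux t u g := by
  simp only [darboux, mul_add, map_add]

theorem darboux_smul (u : Aˣ) (k : K) (f : A) : darboux t u (k • f) = k • darboux t u f := by
  simp only [darboux, mul_smul_comm, Derivation.map_smul]

/-- `u D u^{-1}` as a `K`-linear map. -/
noncomputable def darbouxLin (t : Times K A) (u : Aˣ) : A →ₗ[K] A where
  toFun := darboux t u
  map_add' := darboux_add u
  map_smul' := darboux_smul u

@[simp] theorem darbouxLin_apply (u : Aˣ) (f : A) : darbouxLin t u f = darboux t u f := rfl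

theorem darboux_mul (u : Aˣ) (f s : A) :
    darboux t u (f * s) = darboux t u f * s + f * t.d 1 s := by
  simp only [darboux, ← mul_assoc (↑u⁻¹ : A) f s, Derivation.leibniz, smul_eq_mul, mul_add]
  have := u.mul_inv
  linear_combination (f * t.d 1 s) * this

/-- As T(f) = φ (f/φ)', this is integration by parts for f/φ. The correction term starts with φ,
which spans the obstruction to inverting T since T(φ) = 0. -/
theorem conjD_neg_one_mul_darboux (φ : Aˣ) (f : A) :
    conjD t (-1) φ * 𝐜 (darboux t φ f) * ∂⁻¹ =
      𝐜 f * ∂⁻¹ - 𝐜 (φ : A) * ∂⁻¹ * 𝐜 (↑φ⁻¹ * f) := by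
  calc conjD t (-1) φ * 𝐜 (darboux t φ f) * ∂⁻¹
      = 𝐜 (φ : A) * (∂⁻¹ * ((𝐜 (↑φ⁻¹ : A) * 𝐜 (φ : A)) * 𝐜 (t.d 1 (↑φ⁻¹ * f))) * ∂⁻¹) := by
        simp only [conjD, darboux, C_mul, mul_assoc]
    _ = _ := by
        rw [C_inv_mul_unit, one_mul, D_neg_one_mul_C_mul_D_neg_one, mul_sub, ← mul_assoc,
          ← C_mul, Units.mul_inv_cancel_left, mul_assoc]

theorem mul_conjD_one (φ : Aˣ) {g s : A} (hs : t.d 1 s = φ * g) :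
    ∂⁻¹ * 𝐜 (-(↑φ⁻¹ * s)) * conjD t 1 φ = ∂⁻¹ * 𝐜 g - 𝐜 (↑φ⁻¹ * s) := by
  have h1 : ∂⁻¹ * 𝐜 s * ∂ = 𝐜 s - ∂⁻¹ * 𝐜 (φ * g) := by
    rw [← hs, mul_assoc, eq_sub_iff_add_eq, ← mul_add, ← D_one_mul_C, ← mul_assoc,
      D_neg_one_mul_D_one, one_mul]
  calc ∂⁻¹ * 𝐜 (-(↑φ⁻¹ * s)) * conjD t 1 φ
      = -(∂⁻¹ * 𝐜 (↑φ⁻¹ * s * φ) * ∂ * 𝐜 (↑φ⁻¹ : A)) := by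
        simp only [conjD, C_neg, C_mul, mul_assoc, mul_neg, neg_mul]
    _ = _ := by
        rw [mul_right_comm, Units.inv_mul, one_mul, h1, sub_mul, ← C_mul, mul_assoc, ← C_mul,
          mul_comm s, mul_comm _ (↑φ⁻¹ : A), Units.inv_mul_cancel_left, neg_sub]

theorem res_conjD_one_mul (φ : Aˣ) (Z : PsiDO (t.d 1)) :
    (conjD t 1 φ * Z).res = darboux t φ Z.res + Z.coeff (-2) := by
  rw [conjD, mul_assoc, mul_assoc, res_C_mul, res_D_one_mul, res_C_mul, coeff_C_mul, mul_add,
    Units.mul_inv_cancel_left, darboux, add_comm]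

theorem coeff_neg_two_mul_C_mul_D (L : PsiDO (t.d 1)) (f : A) :
    (L * 𝐜 f * ∂⁻¹).coeff (-2) = L.res * f := by
  rw [coeff_mul_D, ← res_mul_C]
  rfl

/-! ### Actions and concomitants of T L T⁻¹. -/

section DB

variable {φ : Aˣ} {L L' : PsiDO (t.d 1)} (hL : L' = conjD t 1 φ * L * conjD t (-1) φ)
include hL

/-- Moving T out of the residue leaves the coefficients at D⁻², namely Res(L) f and Res(L) φ (f/φ),
and these cancel. -/
theorem act_db (f : A) : L'.act (darboux t φ f) =
    darboux t φ (L.act f) - darboux t φ (L.act φ) * (↑φ⁻¹ * f) := by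
  have h : L' * 𝐜 (darboux t φ f) * ∂⁻¹ =
      conjD t 1 φ * (L * 𝐜 f * ∂⁻¹) - conjD t 1 φ * (L * 𝐜 (φ : A) * ∂⁻¹) * 𝐜 (↑φ⁻¹ * f) := by
    rw [hL, mul_assoc, mul_assoc, ← mul_assoc (conjD t (-1) φ), conjD_neg_one_mul_darboux, mul_sub]
    simp only [mul_assoc]
  rw [act_eq_res, h, res_sub, res_mul_C, res_conjD_one_mul, res_conjD_one_mul,
    coeff_neg_two_mul_C_mul_D, coeff_neg_two_mul_C_mul_D, ← act_eq_res, ← act_eq_res]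
  have := φ.mul_inv
  linear_combination (-(L.res * f)) * this

/-- Here `s` is a potential of φ g. The right side has the shape of `d_neg_inv_mul`, once the
t_r-derivative of `s` is known to be the concomitant and that of φ to be L_+(φ). -/
theorem adjAct_db {g s : A} (hs : t.d 1 s = φ * g) : L'.adjAct (-(↑φ⁻¹ * s)) =
    ↑φ⁻¹ * (L.concomitant φ g - ↑φ⁻¹ * s * L.act φ) := by
  have h : ∂⁻¹ * 𝐜 (-(↑φ⁻¹ * s)) * L' =
      (∂⁻¹ * 𝐜 g * L * 𝐜 (φ : A) * ∂⁻¹ - 𝐜 (↑φ⁻¹ * s) * (L * 𝐜 (φ : A) * ∂⁻¹)) *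
        𝐜 (↑φ⁻¹ : A) := by
    rw [hL, ← mul_assoc, ← mul_assoc, mul_conjD_one φ hs, conjD]
    simp only [mul_assoc, sub_mul]
  rw [adjAct_eq_res, h, res_mul_C, res_sub, res_C_mul, ← act_eq_res L, concomitant, mul_comm]

theorem concomitant_db (f : A) {g s : A} (hs : t.d 1 s = φ * g) :
    L'.concomitant (darboux t φ f) (-(↑φ⁻¹ * s)) =
      L.concomitant f g - L.concomitant φ g * (↑φ⁻¹ * f) -
        ↑φ⁻¹ * s * (L.act f - L.act φ * (↑φ⁻¹ * f)) := by
  have h : ∂⁻¹ * 𝐜 (-(↑φ⁻¹ * s)) * L' * 𝐜 (darboux t φ f) * ∂⁻¹ =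
      ∂⁻¹ * 𝐜 g * L * 𝐜 f * ∂⁻¹ - ∂⁻¹ * 𝐜 g * L * 𝐜 (φ : A) * ∂⁻¹ * 𝐜 (↑φ⁻¹ * f) -
      (𝐜 (↑φ⁻¹ * s) * (L * 𝐜 f * ∂⁻¹) -
        𝐜 (↑φ⁻¹ * s) * (L * 𝐜 (φ : A) * ∂⁻¹ * 𝐜 (↑φ⁻¹ * f))) := by
    rw [hL, ← mul_assoc, ← mul_assoc, mul_conjD_one φ hs, mul_assoc, mul_assoc,
      ← mul_assoc (conjD t (-1) φ), conjD_neg_one_mul_darboux]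
    simp only [mul_assoc, sub_mul, mul_sub]
    abel
  rw [concomitant, h, res_sub, res_sub, res_sub, res_mul_C, res_C_mul, res_C_mul, res_mul_C,
    ← act_eq_res L, ← act_eq_res L, concomitant, concomitant, mul_sub]

end DB

/-! ### Actions and concomitants of the adjoint conjugate of L. -/

section AdjDB

theorem mul_conjD_neg_one (ψ : Aˣ) (g : A) :
    ∂⁻¹ * 𝐜 (darboux t ψ g) * conjD t (-1) ψ⁻¹ =
      𝐜 (↑ψ⁻¹ * g) * (∂⁻¹ * 𝐜 (ψ : A)) - ∂⁻¹ * 𝐜 g := by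
  calc ∂⁻¹ * 𝐜 (darboux t ψ g) * conjD t (-1) ψ⁻¹
      = ∂⁻¹ * 𝐜 (↑ψ⁻¹ * (ψ * t.d 1 (↑ψ⁻¹ * g))) * ∂⁻¹ * 𝐜 (ψ : A) := by
        rw [mul_comm (↑ψ⁻¹ : A) (ψ * _)]
        simp only [conjD, darboux, C_mul, mul_assoc, inv_inv]
    _ = _ := by
        rw [Units.inv_mul_cancel_left, D_neg_one_mul_C_mul_D_neg_one, sub_mul, mul_assoc,
          mul_assoc, ← C_mul, mul_right_comm, Units.inv_mul, one_mul]

theorem conjD_one_mul (ψ : Aˣ) {f s : A} (hs : t.d 1 s = f * ψ) :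
    conjD t 1 ψ⁻¹ * 𝐜 (-(↑ψ⁻¹ * s)) * ∂⁻¹ = -(𝐜 f * ∂⁻¹) - 𝐜 (↑ψ⁻¹ * s) := by
  calc conjD t 1 ψ⁻¹ * 𝐜 (-(↑ψ⁻¹ * s)) * ∂⁻¹
      = -(𝐜 (↑ψ⁻¹ : A) * (∂ * 𝐜 (ψ * (↑ψ⁻¹ * s)) * ∂⁻¹)) := by
        simp only [conjD, C_neg, C_mul, mul_assoc, mul_neg, neg_mul, inv_inv]
    _ = _ := by
        rw [Units.mul_inv_cancel_left, D_one_mul_C, add_mul, mul_assoc, D_one_mul_D_neg_one,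
          mul_one, hs, mul_add, ← C_mul, ← mul_assoc, ← C_mul, mul_comm f,
          Units.inv_mul_cancel_left]
        abel

theorem res_mul_conjD_one (ψ : Aˣ) (Z : PsiDO (t.d 1)) :
    (Z * conjD t 1 ψ⁻¹).res = (∂ * Z).res - darboux t ψ Z.res := by
  rw [conjD, ← mul_assoc, ← mul_assoc, res_mul_C, res_mul_C_mul_D_one, res_D_one_mul, darboux,
    Derivation.leibniz, inv_inv]
  have := ψ.mul_inv
  simp only [smul_eq_mul]
  linear_combination (Z.coeff (-2) + t.d 1 Z.res) * this

variable {ψ : Aˣ} {L L' : PsiDO (t.d 1)} (hL : L' = conjD t (-1) ψ⁻¹ * L * conjD t 1 ψ⁻¹)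
include hL

theorem adjAct_adjDB (g : A) : L'.adjAct (darboux t ψ g) =
    darboux t ψ (L.adjAct g) - darboux t ψ (L.adjAct ψ) * (↑ψ⁻¹ * g) := by
  have h : ∂⁻¹ * 𝐜 (darboux t ψ g) * L' =
      𝐜 (↑ψ⁻¹ * g) * (∂⁻¹ * 𝐜 (ψ : A) * L * conjD t 1 ψ⁻¹) - ∂⁻¹ * 𝐜 g * L * conjD t 1 ψ⁻¹ := by
    rw [hL, ← mul_assoc, ← mul_assoc, mul_conjD_neg_one, sub_mul, sub_mul]
    simp only [mul_assoc]
  have h2 : ∀ g : A, (∂ * (∂⁻¹ * 𝐜 g * L)).res = g * L.res := fun g => by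
    rw [mul_assoc, ← mul_assoc ∂, D_one_mul_D_neg_one, one_mul, res_C_mul]
  rw [adjAct_eq_res, h, res_sub, res_C_mul, res_mul_conjD_one, res_mul_conjD_one,
    h2, h2, ← adjAct_eq_res, ← adjAct_eq_res]
  have := ψ.mul_inv
  linear_combination (L.res * g) * this

theorem act_adjDB {f s : A} (hs : t.d 1 s = f * ψ) : L'.act (-(↑ψ⁻¹ * s)) =
    -(↑ψ⁻¹ * (L.concomitant f ψ + ↑ψ⁻¹ * s * L.adjAct ψ)) := by
  have h : L' * 𝐜 (-(↑ψ⁻¹ * s)) * ∂⁻¹ = -(𝐜 (↑ψ⁻¹ : A) *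
      (∂⁻¹ * 𝐜 (ψ : A) * L * 𝐜 f * ∂⁻¹ + ∂⁻¹ * 𝐜 (ψ : A) * L * 𝐜 (↑ψ⁻¹ * s))) := by
    rw [hL, mul_assoc, mul_assoc, ← mul_assoc (conjD t 1 _), conjD_one_mul ψ hs, conjD]
    simp only [mul_assoc, mul_sub, mul_neg, mul_add, inv_inv]
    abel
  rw [act_eq_res, h, res_neg, res_C_mul, res_add, res_mul_C, ← adjAct_eq_res, concomitant,
    mul_comm (L.adjAct _)]

theorem concomitant_adjDB (g : A) {f s : A} (hs : t.d 1 s = f * ψ) :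
    L'.concomitant (-(↑ψ⁻¹ * s)) (darboux t ψ g) =
      L.concomitant f g - L.concomitant f ψ * (↑ψ⁻¹ * g) +
        ↑ψ⁻¹ * s * (L.adjAct g - L.adjAct ψ * (↑ψ⁻¹ * g)) := by
  have h : ∂⁻¹ * 𝐜 (darboux t ψ g) * L' * 𝐜 (-(↑ψ⁻¹ * s)) * ∂⁻¹ =
      ∂⁻¹ * 𝐜 g * L * 𝐜 f * ∂⁻¹ - 𝐜 (↑ψ⁻¹ * g) * (∂⁻¹ * 𝐜 (ψ : A) * L * 𝐜 f * ∂⁻¹) +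
      (∂⁻¹ * 𝐜 g * L * 𝐜 (↑ψ⁻¹ * s) -
        𝐜 (↑ψ⁻¹ * g) * (∂⁻¹ * 𝐜 (ψ : A) * L * 𝐜 (↑ψ⁻¹ * s))) := by
    rw [hL, ← mul_assoc, ← mul_assoc, mul_conjD_neg_one, mul_assoc, mul_assoc,
      ← mul_assoc (conjD t 1 _), conjD_one_mul ψ hs]
    simp only [mul_assoc, sub_mul, mul_sub, mul_neg]
    abel
  rw [concomitant, h, res_add, res_sub, res_sub, res_C_mul, res_mul_C, res_C_mul, res_mul_C,
    ← adjAct_eq_res, ← adjAct_eq_res, concomitant, concomitant]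
  ring

end AdjDB

end Hierarchy

end KP

namespace KP

/-! ### Coherent hierarchies -/

variable {K A : Type*} [Field K] [CommRing A] [Algebra K A]

theorem iterate_derivation_smul (δ : Derivation K A A) (n : ℕ) (k : K) (f : A) :
    δ^[n] (k • f) = k • δ^[n] f := by
  induction n with
  | zero => rfl
  | succ n ih => rw [Function.iterate_succ_apply', ih, δ.map_smul, Function.iterate_succ_apply']

namespace PsiDO

variable {δ : Derivation K A A}

theorem act_add (P : PsiDO δ) (f g : A) : P.act (f + g) = P.act f + P.act g := by
  simp only [act_eq_res, C_add, mul_add, add_mul, res_add]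

theorem act_smul (P : PsiDO δ) (k : K) (f : A) : P.act (k • f) = k • P.act f := by
  rw [act, act, smul_finsum]
  exact finsum_congr fun j => by
    rw [← mul_smul_comm, iterate_derivation_smul]

theorem adjAct_add (P : PsiDO δ) (f g : A) : P.adjAct (f + g) = P.adjAct f + P.adjAct g := by
  simp only [adjAct_eq_res, C_add, mul_add, add_mul, res_add]

theorem adjAct_smul (P : PsiDO δ) (k : K) (f : A) : P.adjAct (k • f) = k • P.adjAct f := by
  rw [adjAct, adjAct, smul_finsum]
  exact finsum_congr fun j => by
    rw [mul_smul_comm, iterate_derivation_smul, mul_smul_comm]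

/-- `f ↦ P_+(f)` as a `K`-linear map. -/
noncomputable def actLin (P : PsiDO δ) : A →ₗ[K] A where
  toFun := P.act
  map_add' := P.act_add
  map_smul' := P.act_smul

/-- `g ↦ (P^*)_+(g)` as a `K`-linear map. -/
noncomputable def adjActLin (P : PsiDO δ) : A →ₗ[K] A where
  toFun := P.adjAct
  map_add' := P.adjAct_add
  map_smul' := P.adjAct_smul

/-- Displays linearity in `f` through `actLin`, so that relations known on the generators extend to
their span. -/
theorem concomitant_eq_act (P : PsiDO δ) (f g : A) :
    P.concomitant f g = (D δ (-1) * C δ g * P).act f := (act_eq_res _ _).symm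

theorem concomitant_eq_adjAct (P : PsiDO δ) (f g : A) :
    P.concomitant f g = (P * C δ f * D δ (-1)).adjAct g := by
  rw [adjAct_eq_res, concomitant]
  simp only [mul_assoc]

end PsiDO

namespace Hierarchy

open PsiDO

variable {t : Times K A} {m : ℕ}

/-- `f ↦ L(f)` as a `K`-linear map. -/
noncomputable def applyLLin (X : Hierarchy t m) : A →ₗ[K] A :=
  X.L.actLin + ∑ i, LinearMap.mulLeft K (X.Φ i) ∘ₗ X.S.flip (X.Ψ i)

theorem applyLLin_apply (X : Hierarchy t m) (f : A) : X.applyLLin f = X.applyL f := by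
  simp [applyLLin, applyL, actLin]

/-- `g ↦ L^*(g)` as a `K`-linear map. -/
noncomputable def applyLStarLin (X : Hierarchy t m) : A →ₗ[K] A :=
  X.L.adjActLin - ∑ i, LinearMap.mulLeft K (X.Ψ i) ∘ₗ X.S (X.Φ i)

theorem applyLStarLin_apply (X : Hierarchy t m) (f : A) :
    X.applyLStarLin f = X.applyLStar f := by
  simp [applyLStarLin, applyLStar, adjActLin]

theorem chi_succ (X : Hierarchy t m) (c : Fin m) (i : ℕ) :
    X.chi c (i + 1) = X.applyL (X.chi c i) := Function.iterate_succ_apply' _ _ _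

theorem chiStar_succ (X : Hierarchy t m) (c : Fin m) (i : ℕ) :
    X.chiStar c (i + 1) = X.applyLStar (X.chiStar c i) := Function.iterate_succ_apply' _ _ _

/-- The span of the functions `L^i(Φ_a)`. -/
def chiSpan (X : Hierarchy t m) (a : Fin m) : Submodule K A :=
  Submodule.span K (Set.range (X.chi a))

/-- The span of the functions `(L^*)^j(Ψ_b)`. -/
def chiStarSpan (X : Hierarchy t m) (b : Fin m) : Submodule K A :=
  Submodule.span K (Set.range (X.chiStar b))

theorem chi_mem_chiSpan (X : Hierarchy t m) (a : Fin m) (i : ℕ) : X.chi a i ∈ X.chiSpan a :=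
  Submodule.subset_span ⟨i, rfl⟩

theorem chiStar_mem_chiStarSpan (X : Hierarchy t m) (b : Fin m) (i : ℕ) :
    X.chiStar b i ∈ X.chiStarSpan b :=
  Submodule.subset_span ⟨i, rfl⟩

/-- The relations between the functions `L^i(Φ_a)`, `(L^*)^j(Ψ_b)` and their potentials that persist
under (adjoint) Darboux–Bäcklund transformations. -/
structure IsCoherent (X : Hierarchy t m) (r : ℕ+) (a b : Fin m) : Prop where
  dx_left : ∀ i c, t.d 1 (X.S (X.chi a i) (X.Ψ c)) = X.chi a i * X.Ψ c
  dx_right : ∀ c j, t.d 1 (X.S (X.Φ c) (X.chiStar b j)) = X.Φ c * X.chiStar b j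
  dx_sep : ∀ i j, t.d 1 (X.sep a b i j) = X.chi a i * X.chiStar b j
  dr_sep : ∀ i j, t.d r (X.sep a b i j) = X.L.concomitant (X.chi a i) (X.chiStar b j)
  dr_chi : ∀ i, t.d r (X.chi a i) = X.L.act (X.chi a i)
  dr_chiStar : ∀ j, t.d r (X.chiStar b j) = -X.L.adjAct (X.chiStar b j)
  byParts : ∀ i j : ℕ, X.sep a b (i + 1) j - X.sep a b i (j + 1) =
    t.d r (X.sep a b i j) + ∑ c, X.S (X.chi a i) (X.Ψ c) * X.S (X.Φ c) (X.chiStar b j)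

namespace IsCoherent

variable {X : Hierarchy t m} {r : ℕ+} {a b : Fin m} (h : X.IsCoherent r a b)
include h

section

variable {f : A} (hf : f ∈ X.chiSpan a)
include hf

theorem dx_left_span (c : Fin m) : t.d 1 (X.S f (X.Ψ c)) = f * X.Ψ c :=
  LinearMap.eqOn_span (f := (t.d 1 : A →ₗ[K] A) ∘ₗ X.S.flip (X.Ψ c))
    (g := LinearMap.mulRight K (X.Ψ c)) (by rintro _ ⟨i, rfl⟩; exact h.dx_left i c) hf

theorem dx_sep_left (j : ℕ) : t.d 1 (X.S f (X.chiStar b j)) = f * X.chiStar b j :=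
  LinearMap.eqOn_span (f := (t.d 1 : A →ₗ[K] A) ∘ₗ X.S.flip (X.chiStar b j))
    (g := LinearMap.mulRight K (X.chiStar b j)) (by rintro _ ⟨i, rfl⟩; exact h.dx_sep i j) hf

theorem dr_sep_left (j : ℕ) :
    t.d r (X.S f (X.chiStar b j)) = X.L.concomitant f (X.chiStar b j) := by
  rw [concomitant_eq_act]
  refine LinearMap.eqOn_span (f := (t.d r : A →ₗ[K] A) ∘ₗ X.S.flip (X.chiStar b j))
    (g := (D (t.d 1) (-1) * C (t.d 1) (X.chiStar b j) * X.L).actLin) ?_ hf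
  rintro _ ⟨i, rfl⟩
  exact (h.dr_sep i j).trans (concomitant_eq_act _ _ _)

theorem dr_left : t.d r f = X.L.act f :=
  LinearMap.eqOn_span (f := (t.d r : A →ₗ[K] A)) (g := X.L.actLin)
    (by rintro _ ⟨i, rfl⟩; exact h.dr_chi i) hf

theorem byParts_left (j : ℕ) : X.S (X.applyL f) (X.chiStar b j) - X.S f (X.chiStar b (j + 1)) =
    t.d r (X.S f (X.chiStar b j)) + ∑ c, X.S f (X.Ψ c) * X.S (X.Φ c) (X.chiStar b j) := by
  have := LinearMap.eqOn_span
    (f := X.S.flip (X.chiStar b j) ∘ₗ X.applyLLin - X.S.flip (X.chiStar b (j + 1)))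
    (g := (t.d r : A →ₗ[K] A) ∘ₗ X.S.flip (X.chiStar b j) + ∑ c,
      LinearMap.mulRight K (X.S (X.Φ c) (X.chiStar b j)) ∘ₗ X.S.flip (X.Ψ c))
    (s := Set.range (X.chi a)) (by
      rintro _ ⟨i, rfl⟩
      simpa [applyLLin_apply, ← chi_succ, sep] using h.byParts i j) hf
  simpa [applyLLin_apply] using this

end

section

variable {g : A} (hg : g ∈ X.chiStarSpan b)
include hg

theorem dx_right_span (c : Fin m) : t.d 1 (X.S (X.Φ c) g) = X.Φ c * g :=
  LinearMap.eqOn_span (f := (t.d 1 : A →ₗ[K] A) ∘ₗ X.S (X.Φ c))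
    (g := LinearMap.mulLeft K (X.Φ c)) (by rintro _ ⟨i, rfl⟩; exact h.dx_right c i) hg

theorem dx_sep_right (i : ℕ) : t.d 1 (X.S (X.chi a i) g) = X.chi a i * g :=
  LinearMap.eqOn_span (f := (t.d 1 : A →ₗ[K] A) ∘ₗ X.S (X.chi a i))
    (g := LinearMap.mulLeft K (X.chi a i)) (by rintro _ ⟨j, rfl⟩; exact h.dx_sep i j) hg

theorem dr_sep_right (i : ℕ) :
    t.d r (X.S (X.chi a i) g) = X.L.concomitant (X.chi a i) g := by
  rw [concomitant_eq_adjAct]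
  refine LinearMap.eqOn_span (f := (t.d r : A →ₗ[K] A) ∘ₗ X.S (X.chi a i))
    (g := (X.L * C (t.d 1) (X.chi a i) * D (t.d 1) (-1)).adjActLin) ?_ hg
  rintro _ ⟨j, rfl⟩
  exact (h.dr_sep i j).trans (concomitant_eq_adjAct _ _ _)

theorem dr_right : t.d r g = -X.L.adjAct g :=
  LinearMap.eqOn_span (f := (t.d r : A →ₗ[K] A)) (g := -X.L.adjActLin)
    (by rintro _ ⟨i, rfl⟩; exact h.dr_chiStar i) hg

theorem byParts_right (i : ℕ) : X.S (X.chi a (i + 1)) g - X.S (X.chi a i) (X.applyLStar g) =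
    t.d r (X.S (X.chi a i) g) + ∑ c, X.S (X.chi a i) (X.Ψ c) * X.S (X.Φ c) g := by
  have := LinearMap.eqOn_span
    (f := X.S (X.chi a (i + 1)) - X.S (X.chi a i) ∘ₗ X.applyLStarLin)
    (g := (t.d r : A →ₗ[K] A) ∘ₗ X.S (X.chi a i) + ∑ c,
      LinearMap.mulLeft K (X.S (X.chi a i) (X.Ψ c)) ∘ₗ X.S (X.Φ c))
    (s := Set.range (X.chiStar b)) (by
      rintro _ ⟨j, rfl⟩
      simpa [applyLStarLin_apply, ← chiStar_succ, sep] using h.byParts i j) hg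
  simpa [applyLStarLin_apply] using this

end

end IsCoherent

/-- The transformation rules single out the index `a`. Off `a` the summand is given by a uniform
expression that happens to vanish at `a`, so the remaining sum may run over all indices. -/
theorem sum_eq_add_of_eq_off {ι : Type*} [Fintype ι] (a : ι) (F G : ι → A)
    (hFG : ∀ i, i ≠ a → F i = G i) (hG : G a = 0) : ∑ i, F i = F a + ∑ i, G i := by
  classical
  rw [← Finset.add_sum_erase _ F (Finset.mem_univ a), ← Finset.add_sum_erase _ G (Finset.mem_univ a),
    hG, zero_add]
  exact congrArg _ (Finset.sum_congr rfl fun i hi => hFG i (Finset.ne_of_mem_erase hi))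

/-- The shape is that of `act_db` with the flow in place of the action, so evolution under L_+ is
inherited by T(f). -/
theorem d_darboux (k : ℕ+) (u : Aˣ) (f : A) : t.d k (darboux t u f) =
    darboux t u (t.d k f) - darboux t u (t.d k (u : A)) * (↑u⁻¹ * f) := by
  obtain ⟨w, rfl⟩ : ∃ w, f = u * w := ⟨↑u⁻¹ * f, (u.mul_inv_cancel_left f).symm⟩
  have h : (↑u⁻¹ : A) * t.d k (u * w) = t.d k w + ↑u⁻¹ * t.d k (u : A) * w := by
    rw [Derivation.leibniz, smul_eq_mul, smul_eq_mul]
    linear_combination t.d k w * u.inv_mul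
  rw [darboux, darboux, darboux, h, Units.inv_mul_cancel_left]
  simp only [map_add, Derivation.leibniz, smul_eq_mul, t.comm k 1]
  linear_combination (-(t.d 1 w * t.d k (u : A))) * u.mul_inv

theorem d_neg_inv_mul (k : ℕ+) (u : Aˣ) (s : A) : t.d k (-(↑u⁻¹ * s)) =
    -(↑u⁻¹ * (t.d k s - ↑u⁻¹ * s * t.d k (u : A))) := by
  have h := (t.d k).leibniz_of_mul_eq_one u.inv_mul
  rw [map_neg, Derivation.leibniz, h]
  simp only [smul_eq_mul]
  ring

end Hierarchy

end KP

namespace KP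

/-! ### Darboux–Bäcklund transformations preserve coherence -/

variable {K A : Type*} [Field K] [CommRing A] [Algebra K A]

namespace Hierarchy

open PsiDO

variable {t : Times K A} {m : ℕ} {X Y : Hierarchy t m} {r : ℕ+} {a b : Fin m}

/-- Iterating a map that shifts the `p i` up to multiples of `p 0` changes them only by a
unitriangular matrix over the constants. -/
theorem exists_unitriangular {p : ℕ → A} {y : ℕ → A} {F : A →ₗ[K] A} {κ : ℕ → K}
    (h0 : y 0 = p 0) (hy : ∀ i, y (i + 1) = F (y i))
    (hp : ∀ i, F (p i) = p (i + 1) + κ i • p 0) (i : ℕ) :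
    ∃ u : ℕ → K, u i = 1 ∧ y i = ∑ j ∈ Finset.range (i + 1), u j • p j := by
  induction i with
  | zero => exact ⟨fun _ => 1, rfl, by simp [h0]⟩
  | succ i ih =>
    obtain ⟨u, h1, h3⟩ := ih
    -- The old coefficients shift by one place, and the new coefficient of `p 0` collects all the
    -- constants `κ j`.
    refine ⟨fun j => Nat.casesOn j (∑ j ∈ Finset.range (i + 1), u j * κ j) u, h1, ?_⟩
    rw [hy, h3, map_sum, Finset.sum_range_succ' _ (i + 1)]
    change _ = _ + (∑ j ∈ Finset.range (i + 1), u j * κ j) • p 0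
    rw [Finset.sum_smul, ← Finset.sum_add_distrib]
    refine Finset.sum_congr rfl fun j _ => ?_
    rw [map_smul, hp, smul_add, mul_smul]

theorem applyL_mem_chiSpan (X : Hierarchy t m) (a : Fin m) {f : A} (hf : f ∈ X.chiSpan a) :
    X.applyL f ∈ X.chiSpan a := by
  rw [← applyLLin_apply]
  refine (Submodule.span_le (p := (X.chiSpan a).comap X.applyLLin)).2 ?_ hf
  rintro _ ⟨i, rfl⟩
  change X.applyLLin (X.chi a i) ∈ X.chiSpan a
  rw [applyLLin_apply, ← chi_succ]
  exact X.chi_mem_chiSpan a _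

theorem d_sep_transform (u : Aˣ) {f g F s : A} (hF : t.d 1 F = f * g) (hs : t.d 1 s = u * g) :
    t.d 1 (F - f * (↑u⁻¹ : A) * s) = darboux t u f * -(↑u⁻¹ * s) := by
  rw [mul_comm f, darboux, map_sub, hF, Derivation.leibniz, hs, smul_eq_mul, smul_eq_mul]
  linear_combination (s * t.d 1 (↑u⁻¹ * f) - f * g) * u.mul_inv

theorem darboux_sum (u : Aˣ) {ι : Type*} (s : Finset ι) (F : ι → A) :
    darboux t u (∑ i ∈ s, F i) = ∑ i ∈ s, darboux t u (F i) :=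
  map_sum (darbouxLin t u) F s

namespace IsDB

variable {φ : Aˣ} (hY : IsDB a φ X Y)
include hY

theorem chi_zero : X.chi a 0 = φ := hY.unit_eq.symm

theorem S_eq {f : A} (hf : f ∈ X.chiSpan a) (e : Fin m) (j : ℕ) :
    Y.S (darboux t φ f) (-((↑φ⁻¹ : A) * X.S φ (X.chiStar e j))) =
      X.S f (X.chiStar e j) - f * (↑φ⁻¹ : A) * X.S φ (X.chiStar e j) :=
  LinearMap.eqOn_span
    (f := Y.S.flip (-((↑φ⁻¹ : A) * X.S φ (X.chiStar e j))) ∘ₗ darbouxLin t φ)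
    (g := X.S.flip (X.chiStar e j) -
      LinearMap.mulRight K (X.S φ (X.chiStar e j)) ∘ₗ LinearMap.mulRight K (↑φ⁻¹ : A))
    (s := Set.range (X.chi a))
    (by rintro _ ⟨i, rfl⟩; rw [hY.unit_eq]; exact hY.sep a e i j) hf

theorem S_self {f : A} (hf : f ∈ X.chiSpan a) : ∃ κ : K,
    Y.S (darboux t φ f) (↑φ⁻¹ : A) = f * (↑φ⁻¹ : A) + algebraMap K A κ := by
  refine Submodule.span_induction (p := fun f _ => ∃ κ : K,
    Y.S (darboux t φ f) (↑φ⁻¹ : A) = f * (↑φ⁻¹ : A) + algebraMap K A κ) ?_ ?_ ?_ ?_ hf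
  · rintro _ ⟨i, rfl⟩
    exact hY.sep_self a i
  · exact ⟨0, by simp [darboux]⟩
  · rintro x y _ _ ⟨k, hk⟩ ⟨l, hl⟩
    exact ⟨k + l, by rw [darboux_add, map_add, LinearMap.add_apply, hk, hl, map_add]; ring⟩
  · rintro c x _ ⟨k, hk⟩
    refine ⟨c * k, ?_⟩
    rw [darboux_smul, map_smul, LinearMap.smul_apply, hk, map_mul, smul_add, smul_mul_assoc,
      Algebra.smul_def c (algebraMap K A k)]

theorem psi_eq (c : Fin m) (hc : c ≠ a) : Y.Ψ c = -((↑φ⁻¹ : A) * X.S φ (X.chiStar c 0)) := by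
  rw [hY.psi c hc, hY.unit_eq]; rfl

theorem phi_self_eq : Y.Φ a = darboux t φ (X.chi a 1) := hY.phi_self

theorem S_phi (c : Fin m) (hc : c ≠ a) (e : Fin m) (j : ℕ) :
    Y.S (Y.Φ c) (-((↑φ⁻¹ : A) * X.S φ (X.chiStar e j))) =
      X.S (X.Φ c) (X.chiStar e j) - X.Φ c * (↑φ⁻¹ : A) * X.S φ (X.chiStar e j) := by
  rw [hY.phi c hc, hY.unit_eq]
  exact hY.sep c e 0 j

section

variable (h : X.IsCoherent r a b)
include h

/-- The only potential not determined exactly is the one with 1/φ = `Y.Ψ a`. Its constant `κ`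
multiplies `Y.Φ a` = T(L(Φ_a)), which is the whole failure of L and T to intertwine. -/
theorem applyL_eq {f : A} (hf : f ∈ X.chiSpan a) {κ : K}
    (hκ : Y.S (darboux t φ f) (↑φ⁻¹ : A) = f * (↑φ⁻¹ : A) + algebraMap K A κ) :
    Y.applyL (darboux t φ f) =
      darboux t φ (X.applyL f) + κ • darboux t φ (X.chi a 1) := by
  have h1 : X.chi a 1 = X.L.act φ + ∑ i, X.Φ i * X.S φ (X.Ψ i) := by
    rw [chi_succ, hY.chi_zero, applyL]
  have hφ : (φ : A) ∈ X.chiSpan a := hY.chi_zero ▸ X.chi_mem_chiSpan a 0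
  rw [applyL, applyL, act_db hY.lax, sum_eq_add_of_eq_off a _
    (fun i => darboux t φ (X.Φ i) * (X.S f (X.Ψ i) - f * (↑φ⁻¹ : A) * X.S φ (X.Ψ i)))]
  · have hT : darboux t φ (X.chi a 1) = darboux t φ (X.L.act φ) +
        ∑ i, (darboux t φ (X.Φ i) * X.S φ (X.Ψ i) + X.Φ i * (φ * X.Ψ i)) := by
      rw [h1, darboux_add, darboux_sum]
      simp only [darboux_mul, h.dx_left_span hφ]
    have hT2 : darboux t φ (∑ i, X.Φ i * X.S f (X.Ψ i)) =
        ∑ i, (darboux t φ (X.Φ i) * X.S f (X.Ψ i) + X.Φ i * (f * X.Ψ i)) := by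
      rw [darboux_sum]
      simp only [darboux_mul, h.dx_left_span hf]
    have hsum : (∑ i, (darboux t φ (X.Φ i) * X.S φ (X.Ψ i) + X.Φ i * (φ * X.Ψ i))) *
        (f * (↑φ⁻¹ : A)) + ∑ i, darboux t φ (X.Φ i) *
          (X.S f (X.Ψ i) - f * (↑φ⁻¹ : A) * X.S φ (X.Ψ i)) =
        ∑ i, (darboux t φ (X.Φ i) * X.S f (X.Ψ i) + X.Φ i * (f * X.Ψ i)) := by
      rw [Finset.sum_mul, ← Finset.sum_add_distrib]
      refine Finset.sum_congr rfl fun i _ => ?_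
      linear_combination (X.Φ i * X.Ψ i * f) * φ.mul_inv
    rw [hY.psi_self, hκ, hY.phi_self_eq, darboux_add, hT2, ← hsum, Algebra.smul_def]
    linear_combination (f * (↑φ⁻¹ : A)) * hT
  · intro i hi
    rw [hY.phi i hi, hY.psi_eq i hi, hY.S_eq hf]
    rfl
  · rw [← hY.unit_eq, darboux_self, zero_mul]

theorem exists_chi_eq (i : ℕ) : ∃ u : ℕ → K, u i = 1 ∧
    Y.chi a i = ∑ j ∈ Finset.range (i + 1), u j • darboux t φ (X.chi a (j + 1)) := by
  choose κ hκ using fun i => hY.S_self (X.chi_mem_chiSpan a i)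
  -- The generators are T of `X.chi a (j + 1)`, because T kills `X.chi a 0`; hence the constants are
  -- shifted as well.
  refine exists_unitriangular (F := Y.applyLLin) (κ := fun i => κ (i + 1))
    (p := fun j => darboux t φ (X.chi a (j + 1))) hY.phi_self
    (fun i => ?_) (fun i => ?_) i
  · rw [applyLLin_apply, chi_succ]
  · rw [applyLLin_apply, hY.applyL_eq h (X.chi_mem_chiSpan a _) (hκ _), ← chi_succ]

theorem exists_chi_eq_darboux (i : ℕ) : ∃ f ∈ X.chiSpan a, Y.chi a i = darboux t φ f := by
  obtain ⟨u, -, hu⟩ := hY.exists_chi_eq h i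
  refine ⟨∑ j ∈ Finset.range (i + 1), u j • X.chi a (j + 1), Submodule.sum_mem _ fun j _ =>
    Submodule.smul_mem _ _ (X.chi_mem_chiSpan a _), ?_⟩
  rw [hu, darboux_sum]
  simp only [darboux_smul]

theorem dx_S (j : ℕ) : t.d 1 (X.S φ (X.chiStar b j)) = φ * X.chiStar b j := by
  rw [hY.unit_eq]; exact h.dx_right a j

/-- Once the actions are expanded, this is integration by parts for the pair of Φ_a and the `j`-th
adjoint function. No constant enters, as the potentials involved are prescribed exactly. -/
theorem applyLStar_eq (j : ℕ) : Y.applyLStar (-((↑φ⁻¹ : A) * X.S φ (X.chiStar b j))) =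
    -((↑φ⁻¹ : A) * X.S φ (X.chiStar b (j + 1))) := by
  have h1 : X.chi a 1 = X.L.act φ + ∑ i, X.Φ i * X.S φ (X.Ψ i) := by
    rw [chi_succ, hY.chi_zero, applyL]
  have hb := h.byParts 0 j
  rw [h.dr_sep] at hb
  simp only [Hierarchy.sep, hY.chi_zero, zero_add] at hb
  rw [applyLStar, adjAct_db hY.lax (hY.dx_S h j), sum_eq_add_of_eq_off a _
    (fun i => -((↑φ⁻¹ : A) * X.S φ (X.Ψ i)) * (X.S (X.Φ i) (X.chiStar b j) -
      X.Φ i * (↑φ⁻¹ : A) * X.S φ (X.chiStar b j)))]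
  · have hsum : ∑ i, -((↑φ⁻¹ : A) * X.S φ (X.Ψ i)) * (X.S (X.Φ i) (X.chiStar b j) -
        X.Φ i * (↑φ⁻¹ : A) * X.S φ (X.chiStar b j)) =
        -(↑φ⁻¹ : A) * ∑ i, X.S φ (X.Ψ i) * X.S (X.Φ i) (X.chiStar b j) +
        (↑φ⁻¹ : A) * (↑φ⁻¹ : A) * X.S φ (X.chiStar b j) * ∑ i, X.Φ i * X.S φ (X.Ψ i) := by
      rw [Finset.mul_sum, Finset.mul_sum, ← Finset.sum_add_distrib]
      exact Finset.sum_congr rfl fun i _ => by ring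
    rw [hY.psi_self, hY.phi_self_eq, hY.S_eq (X.chi_mem_chiSpan a 1), hsum, h1]
    rw [h1] at hb
    linear_combination (-(↑φ⁻¹ : A)) * hb
  · intro i hi
    rw [hY.psi_eq i hi, hY.S_phi i hi]
    rfl
  · rw [← hY.unit_eq, Units.mul_inv, one_mul, sub_self, mul_zero]

variable (hab : a ≠ b)
include hab

theorem chiStar_eq (j : ℕ) : Y.chiStar b j = -((↑φ⁻¹ : A) * X.S φ (X.chiStar b j)) := by
  induction j with
  | zero => exact hY.psi_eq b hab.symm
  | succ j ih => rw [chiStar_succ, ih, hY.applyLStar_eq h]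

theorem isCoherent : Y.IsCoherent r a b := by
  have hφ : (φ : A) ∈ X.chiSpan a := hY.chi_zero ▸ X.chi_mem_chiSpan a 0
  have hdr : ∀ {f : A} (_ : f ∈ X.chiSpan a) (j : ℕ),
      t.d r (X.S f (X.chiStar b j) - f * (↑φ⁻¹ : A) * X.S φ (X.chiStar b j)) =
        X.L.concomitant f (X.chiStar b j) - (↑φ⁻¹ : A) * X.S φ (X.chiStar b j) * X.L.act f -
        f * (↑φ⁻¹ * (X.L.concomitant φ (X.chiStar b j) -
          ↑φ⁻¹ * X.S φ (X.chiStar b j) * X.L.act φ)) := by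
    intro f hf j
    have e : X.S f (X.chiStar b j) - f * (↑φ⁻¹ : A) * X.S φ (X.chiStar b j) =
      X.S f (X.chiStar b j) + f * -((↑φ⁻¹ : A) * X.S φ (X.chiStar b j)) := by ring
    rw [e, map_add, Derivation.leibniz, d_neg_inv_mul, h.dr_sep_left hf, h.dr_sep_left hφ,
      h.dr_left hf, h.dr_left hφ, smul_eq_mul, smul_eq_mul]
    ring
  constructor
  · intro i c
    obtain ⟨f, hf, hfi⟩ := hY.exists_chi_eq_darboux h i
    rw [hfi]
    by_cases hc : c = a
    · subst hc
      obtain ⟨κ, hκ⟩ := hY.S_self hf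
      rw [hY.psi_self, hκ, map_add, Derivation.map_algebraMap, add_zero, darboux, mul_comm f]
      linear_combination (-(t.d 1 (↑φ⁻¹ * f))) * φ.mul_inv
    · rw [hY.psi_eq c hc, hY.S_eq hf]
      exact d_sep_transform φ (h.dx_left_span hf c) (h.dx_left_span hφ c)
  · intro c j
    rw [hY.chiStar_eq h hab]
    by_cases hc : c = a
    · subst hc
      rw [hY.phi_self_eq, hY.S_eq (X.chi_mem_chiSpan _ 1)]
      exact d_sep_transform φ (h.dx_sep 1 j) (hY.dx_S h j)
    · rw [hY.S_phi c hc, hY.phi c hc]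
      exact d_sep_transform φ (h.dx_right c j) (hY.dx_S h j)
  · intro i j
    obtain ⟨f, hf, hfi⟩ := hY.exists_chi_eq_darboux h i
    rw [Hierarchy.sep, hfi, hY.chiStar_eq h hab, hY.S_eq hf]
    exact d_sep_transform φ (h.dx_sep_left hf j) (hY.dx_S h j)
  · intro i j
    obtain ⟨f, hf, hfi⟩ := hY.exists_chi_eq_darboux h i
    rw [Hierarchy.sep, hfi, hY.chiStar_eq h hab, hY.S_eq hf,
      concomitant_db hY.lax _ (hY.dx_S h j), hdr hf]
    ring
  · intro i
    obtain ⟨f, hf, hfi⟩ := hY.exists_chi_eq_darboux h i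
    rw [hfi, d_darboux, act_db hY.lax, h.dr_left hf, h.dr_left hφ]
  · intro j
    rw [hY.chiStar_eq h hab, adjAct_db hY.lax (hY.dx_S h j), d_neg_inv_mul, h.dr_sep_left hφ,
      h.dr_left hφ]
  · intro i j
    obtain ⟨f, hf, hfi⟩ := hY.exists_chi_eq_darboux h i
    obtain ⟨κ, hκ⟩ := hY.S_self hf
    have h1 : X.chi a 1 = X.L.act φ + ∑ i, X.Φ i * X.S φ (X.Ψ i) := by
      rw [chi_succ, hY.chi_zero, applyL]
    have hb := h.byParts 0 j
    rw [h.dr_sep] at hb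
    simp only [Hierarchy.sep, hY.chi_zero, zero_add] at hb
    have hb2 := h.byParts_left hf j
    rw [h.dr_sep_left hf, applyL] at hb2
    rw [h1] at hb
    rw [Hierarchy.sep, Hierarchy.sep, Hierarchy.sep, chi_succ, hfi, hY.applyL_eq h hf hκ,
      hY.chiStar_eq h hab, hY.chiStar_eq h hab, hY.S_eq hf, hY.S_eq hf, hdr hf, map_add,
      LinearMap.add_apply, map_smul, LinearMap.smul_apply, hY.S_eq (X.applyL_mem_chiSpan a hf),
      hY.S_eq (X.chi_mem_chiSpan a 1), sum_eq_add_of_eq_off a _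
      (fun i => (X.S f (X.Ψ i) - f * (↑φ⁻¹ : A) * X.S φ (X.Ψ i)) *
        (X.S (X.Φ i) (X.chiStar b j) - X.Φ i * (↑φ⁻¹ : A) * X.S φ (X.chiStar b j)))]
    · have hsum : ∑ i, (X.S f (X.Ψ i) - f * (↑φ⁻¹ : A) * X.S φ (X.Ψ i)) *
          (X.S (X.Φ i) (X.chiStar b j) - X.Φ i * (↑φ⁻¹ : A) * X.S φ (X.chiStar b j)) =
          ∑ i, X.S f (X.Ψ i) * X.S (X.Φ i) (X.chiStar b j) -
          (↑φ⁻¹ : A) * X.S φ (X.chiStar b j) * ∑ i, X.Φ i * X.S f (X.Ψ i) -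
          f * (↑φ⁻¹ : A) * ∑ i, X.S φ (X.Ψ i) * X.S (X.Φ i) (X.chiStar b j) +
          f * (↑φ⁻¹ : A) * ((↑φ⁻¹ : A) * X.S φ (X.chiStar b j)) *
            ∑ i, X.Φ i * X.S φ (X.Ψ i) := by
        simp only [Finset.mul_sum, ← Finset.sum_sub_distrib, ← Finset.sum_add_distrib]
        exact Finset.sum_congr rfl fun i _ => by ring
      rw [hY.psi_self, hκ, hY.phi_self_eq, hY.S_eq (X.chi_mem_chiSpan a 1), hsum, h1,
        applyL, Algebra.smul_def]
      -- Integration by parts for `f` minus f/φ times that for φ. The terms with `κ` on the two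
      -- sides, from L(T f) and from the summand `c = a`, cancel.
      linear_combination hb2 - f * (↑φ⁻¹ : A) * hb
    · intro c hc
      rw [hY.psi_eq c hc, hY.S_eq hf, hY.S_phi c hc]
      rfl
    · rw [← hY.unit_eq, Units.mul_inv, one_mul, sub_self, mul_zero]

end

end IsDB

end Hierarchy

end KP

namespace KP

/-! ### Adjoint Darboux–Bäcklund transformations preserve coherence -/

variable {K A : Type*} [Field K] [CommRing A] [Algebra K A]

namespace Hierarchy

open PsiDO

variable {t : Times K A} {m : ℕ} {X Y : Hierarchy t m} {r : ℕ+} {a b : Fin m}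

theorem applyLStar_mem_chiStarSpan (X : Hierarchy t m) (b : Fin m) {g : A}
    (hg : g ∈ X.chiStarSpan b) : X.applyLStar g ∈ X.chiStarSpan b := by
  rw [← applyLStarLin_apply]
  refine (Submodule.span_le (p := (X.chiStarSpan b).comap X.applyLStarLin)).2 ?_ hg
  rintro _ ⟨i, rfl⟩
  change X.applyLStarLin (X.chiStar b i) ∈ X.chiStarSpan b
  rw [applyLStarLin_apply, ← chiStar_succ]
  exact X.chiStar_mem_chiStarSpan b _

theorem d_sep_transform_adj (u : Aˣ) {f g F s : A} (hF : t.d 1 F = f * g)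
    (hs : t.d 1 s = f * u) :
    t.d 1 (F - g * (↑u⁻¹ : A) * s) = -(↑u⁻¹ * s) * darboux t u g := by
  rw [d_sep_transform u (hF.trans (mul_comm _ _)) (hs.trans (mul_comm _ _)), mul_comm]

namespace IsAdjDB

variable {ψ : Aˣ} (hY : IsAdjDB b ψ X Y)
include hY

theorem chiStar_zero : X.chiStar b 0 = ψ := hY.unit_eq.symm

theorem S_eq {g : A} (hg : g ∈ X.chiStarSpan b) (c : Fin m) (i : ℕ) :
    Y.S (-((↑ψ⁻¹ : A) * X.S (X.chi c i) ψ)) (darboux t ψ g) =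
      X.S (X.chi c i) g - g * (↑ψ⁻¹ : A) * X.S (X.chi c i) ψ :=
  LinearMap.eqOn_span
    (f := Y.S (-((↑ψ⁻¹ : A) * X.S (X.chi c i) ψ)) ∘ₗ darbouxLin t ψ)
    (g := X.S (X.chi c i) -
      LinearMap.mulRight K (X.S (X.chi c i) ψ) ∘ₗ LinearMap.mulRight K (↑ψ⁻¹ : A))
    (s := Set.range (X.chiStar b))
    (by rintro _ ⟨j, rfl⟩; rw [hY.unit_eq]; exact hY.sep c b i j) hg

theorem S_self {g : A} (hg : g ∈ X.chiStarSpan b) : ∃ κ : K,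
    Y.S (-(↑ψ⁻¹ : A)) (darboux t ψ g) = -(g * (↑ψ⁻¹ : A)) + algebraMap K A κ := by
  refine Submodule.span_induction (p := fun g _ => ∃ κ : K,
    Y.S (-(↑ψ⁻¹ : A)) (darboux t ψ g) = -(g * (↑ψ⁻¹ : A)) + algebraMap K A κ) ?_ ?_ ?_ ?_ hg
  · rintro _ ⟨i, rfl⟩
    exact hY.sep_self b i
  · exact ⟨0, by simp [darboux]⟩
  · rintro x y _ _ ⟨k, hk⟩ ⟨l, hl⟩
    exact ⟨k + l, by rw [darboux_add, map_add, hk, hl, map_add]; ring⟩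
  · rintro c x _ ⟨k, hk⟩
    refine ⟨c * k, ?_⟩
    rw [darboux_smul, map_smul, hk, map_mul, smul_add, smul_neg, smul_mul_assoc,
      Algebra.smul_def c (algebraMap K A k)]

theorem phi_eq (c : Fin m) (hc : c ≠ b) : Y.Φ c = -((↑ψ⁻¹ : A) * X.S (X.chi c 0) ψ) := by
  rw [hY.phi c hc, hY.unit_eq]; rfl

theorem psi_self_eq : Y.Ψ b = darboux t ψ (X.chiStar b 1) := hY.psi_self

theorem S_psi (e : Fin m) (he : e ≠ b) (c : Fin m) (i : ℕ) :
    Y.S (-((↑ψ⁻¹ : A) * X.S (X.chi c i) ψ)) (Y.Ψ e) =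
      X.S (X.chi c i) (X.Ψ e) - X.Ψ e * (↑ψ⁻¹ : A) * X.S (X.chi c i) ψ := by
  rw [hY.psi e he, hY.unit_eq]
  exact hY.sep c e i 0

section

variable (h : X.IsCoherent r a b)
include h

/-- Dual to the DB case: the undetermined potential is the one with -1/ψ = `Y.Φ b`, and the minus
sign in L^* makes the constant enter negatively. -/
theorem applyLStar_eq {g : A} (hg : g ∈ X.chiStarSpan b) {κ : K}
    (hκ : Y.S (-(↑ψ⁻¹ : A)) (darboux t ψ g) = -(g * (↑ψ⁻¹ : A)) + algebraMap K A κ) :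
    Y.applyLStar (darboux t ψ g) =
      darboux t ψ (X.applyLStar g) - κ • darboux t ψ (X.chiStar b 1) := by
  have h1 : X.chiStar b 1 = X.L.adjAct ψ - ∑ i, X.Ψ i * X.S (X.Φ i) ψ := by
    rw [chiStar_succ, hY.chiStar_zero, applyLStar]
  have hψ : (ψ : A) ∈ X.chiStarSpan b := hY.chiStar_zero ▸ X.chiStar_mem_chiStarSpan b 0
  rw [applyLStar, applyLStar, adjAct_adjDB hY.lax, sum_eq_add_of_eq_off b _
    (fun i => darboux t ψ (X.Ψ i) * (X.S (X.Φ i) g - g * (↑ψ⁻¹ : A) * X.S (X.Φ i) ψ))]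
  · have hT : darboux t ψ (X.chiStar b 1) = darboux t ψ (X.L.adjAct ψ) -
        ∑ i, (darboux t ψ (X.Ψ i) * X.S (X.Φ i) ψ + X.Ψ i * (X.Φ i * ψ)) := by
      rw [h1, ← darbouxLin_apply, map_sub, darbouxLin_apply, darbouxLin_apply, darboux_sum]
      simp only [darboux_mul, h.dx_right_span hψ]
    have hT2 : darboux t ψ (X.L.adjAct g - ∑ i, X.Ψ i * X.S (X.Φ i) g) =
        darboux t ψ (X.L.adjAct g) -
        ∑ i, (darboux t ψ (X.Ψ i) * X.S (X.Φ i) g + X.Ψ i * (X.Φ i * g)) := by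
      rw [← darbouxLin_apply, map_sub, darbouxLin_apply, darbouxLin_apply, darboux_sum]
      simp only [darboux_mul, h.dx_right_span hg]
    have hsum : (∑ i, (darboux t ψ (X.Ψ i) * X.S (X.Φ i) ψ + X.Ψ i * (X.Φ i * ψ))) *
        (g * (↑ψ⁻¹ : A)) + ∑ i, darboux t ψ (X.Ψ i) *
          (X.S (X.Φ i) g - g * (↑ψ⁻¹ : A) * X.S (X.Φ i) ψ) =
        ∑ i, (darboux t ψ (X.Ψ i) * X.S (X.Φ i) g + X.Ψ i * (X.Φ i * g)) := by
      rw [Finset.sum_mul, ← Finset.sum_add_distrib]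
      refine Finset.sum_congr rfl fun i _ => ?_
      linear_combination (X.Φ i * X.Ψ i * g) * ψ.mul_inv
    rw [hY.phi_self, hκ, hY.psi_self_eq, hT2, ← hsum, Algebra.smul_def]
    linear_combination (g * (↑ψ⁻¹ : A)) * hT
  · intro i hi
    rw [hY.psi i hi, hY.phi_eq i hi, hY.S_eq hg]
    rfl
  · rw [← hY.unit_eq, darboux_self, zero_mul]

theorem exists_chiStar_eq (i : ℕ) : ∃ u : ℕ → K, u i = 1 ∧
    Y.chiStar b i = ∑ j ∈ Finset.range (i + 1), u j • darboux t ψ (X.chiStar b (j + 1)) := by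
  choose κ hκ using fun i => hY.S_self (X.chiStar_mem_chiStarSpan b i)
  refine exists_unitriangular (F := Y.applyLStarLin) (κ := fun i => -κ (i + 1))
    (p := fun j => darboux t ψ (X.chiStar b (j + 1))) hY.psi_self
    (fun i => ?_) (fun i => ?_) i
  · rw [applyLStarLin_apply, chiStar_succ]
  · rw [applyLStarLin_apply, hY.applyLStar_eq h (X.chiStar_mem_chiStarSpan b _) (hκ _),
      ← chiStar_succ, neg_smul, sub_eq_add_neg]

theorem exists_chiStar_eq_darboux (i : ℕ) :
    ∃ g ∈ X.chiStarSpan b, Y.chiStar b i = darboux t ψ g := by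
  obtain ⟨u, -, hu⟩ := hY.exists_chiStar_eq h i
  refine ⟨∑ j ∈ Finset.range (i + 1), u j • X.chiStar b (j + 1), Submodule.sum_mem _ fun j _ =>
    Submodule.smul_mem _ _ (X.chiStar_mem_chiStarSpan b _), ?_⟩
  rw [hu, darboux_sum]
  simp only [darboux_smul]

theorem dx_S (i : ℕ) : t.d 1 (X.S (X.chi a i) ψ) = X.chi a i * ψ := by
  rw [hY.unit_eq]; exact h.dx_left i b

theorem applyL_eq (i : ℕ) : Y.applyL (-((↑ψ⁻¹ : A) * X.S (X.chi a i) ψ)) =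
    -((↑ψ⁻¹ : A) * X.S (X.chi a (i + 1)) ψ) := by
  have h1 : X.chiStar b 1 = X.L.adjAct ψ - ∑ i, X.Ψ i * X.S (X.Φ i) ψ := by
    rw [chiStar_succ, hY.chiStar_zero, applyLStar]
  have hb := h.byParts i 0
  rw [h.dr_sep] at hb
  simp only [Hierarchy.sep, hY.chiStar_zero, zero_add] at hb
  rw [applyL, act_adjDB hY.lax (hY.dx_S h i), sum_eq_add_of_eq_off b _
    (fun c => -((↑ψ⁻¹ : A) * X.S (X.Φ c) ψ) * (X.S (X.chi a i) (X.Ψ c) -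
      X.Ψ c * (↑ψ⁻¹ : A) * X.S (X.chi a i) ψ))]
  · have hsum : ∑ c, -((↑ψ⁻¹ : A) * X.S (X.Φ c) ψ) * (X.S (X.chi a i) (X.Ψ c) -
        X.Ψ c * (↑ψ⁻¹ : A) * X.S (X.chi a i) ψ) =
        -(↑ψ⁻¹ : A) * ∑ c, X.S (X.chi a i) (X.Ψ c) * X.S (X.Φ c) ψ +
        (↑ψ⁻¹ : A) * (↑ψ⁻¹ : A) * X.S (X.chi a i) ψ * ∑ c, X.Ψ c * X.S (X.Φ c) ψ := by
      rw [Finset.mul_sum, Finset.mul_sum, ← Finset.sum_add_distrib]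
      exact Finset.sum_congr rfl fun i _ => by ring
    rw [hY.phi_self, hY.psi_self_eq, hY.S_eq (X.chiStar_mem_chiStarSpan b 1), hsum, h1]
    rw [h1] at hb
    linear_combination (↑ψ⁻¹ : A) * hb
  · intro c hc
    rw [hY.phi_eq c hc, hY.S_psi c hc]
    rfl
  · rw [← hY.unit_eq, Units.mul_inv, one_mul, sub_self, mul_zero]

variable (hab : a ≠ b)
include hab

theorem chi_eq (i : ℕ) : Y.chi a i = -((↑ψ⁻¹ : A) * X.S (X.chi a i) ψ) := by
  induction i with
  | zero => exact hY.phi_eq a hab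
  | succ i ih => rw [chi_succ, ih, hY.applyL_eq h]

theorem isCoherent : Y.IsCoherent r a b := by
  have hψ : (ψ : A) ∈ X.chiStarSpan b := hY.chiStar_zero ▸ X.chiStar_mem_chiStarSpan b 0
  have hdr : ∀ {g : A} (_ : g ∈ X.chiStarSpan b) (i : ℕ),
      t.d r (X.S (X.chi a i) g - g * (↑ψ⁻¹ : A) * X.S (X.chi a i) ψ) =
        X.L.concomitant (X.chi a i) g + (↑ψ⁻¹ : A) * X.S (X.chi a i) ψ * X.L.adjAct g -
        g * (↑ψ⁻¹ * (X.L.concomitant (X.chi a i) ψ +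
          ↑ψ⁻¹ * X.S (X.chi a i) ψ * X.L.adjAct ψ)) := by
    intro g hg i
    have e : X.S (X.chi a i) g - g * (↑ψ⁻¹ : A) * X.S (X.chi a i) ψ =
      X.S (X.chi a i) g + g * -((↑ψ⁻¹ : A) * X.S (X.chi a i) ψ) := by ring
    rw [e, map_add, Derivation.leibniz, d_neg_inv_mul, h.dr_sep_right hg, h.dr_sep_right hψ,
      h.dr_right hg, h.dr_right hψ, smul_eq_mul, smul_eq_mul]
    ring
  constructor
  · intro i c
    rw [hY.chi_eq h hab]
    by_cases hc : c = b
    · subst hc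
      rw [hY.psi_self_eq, hY.S_eq (X.chiStar_mem_chiStarSpan _ 1)]
      exact d_sep_transform_adj ψ (h.dx_sep i 1) (hY.dx_S h i)
    · rw [hY.S_psi c hc, hY.psi c hc]
      exact d_sep_transform_adj ψ (h.dx_left i c) (hY.dx_S h i)
  · intro c j
    obtain ⟨g, hg, hgj⟩ := hY.exists_chiStar_eq_darboux h j
    rw [hgj]
    by_cases hc : c = b
    · subst hc
      obtain ⟨κ, hκ⟩ := hY.S_self hg
      rw [hY.phi_self, hκ, map_add, Derivation.map_algebraMap, add_zero, darboux, mul_comm g,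
        map_neg]
      linear_combination (t.d 1 (↑ψ⁻¹ * g)) * ψ.mul_inv
    · rw [hY.phi_eq c hc, hY.S_eq hg]
      exact d_sep_transform_adj ψ (h.dx_right_span hg c) (h.dx_right_span hψ c)
  · intro i j
    obtain ⟨g, hg, hgj⟩ := hY.exists_chiStar_eq_darboux h j
    rw [Hierarchy.sep, hgj, hY.chi_eq h hab, hY.S_eq hg]
    exact d_sep_transform_adj ψ (h.dx_sep_right hg i) (hY.dx_S h i)
  · intro i j
    obtain ⟨g, hg, hgj⟩ := hY.exists_chiStar_eq_darboux h j
    rw [Hierarchy.sep, hgj, hY.chi_eq h hab, hY.S_eq hg,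
      concomitant_adjDB hY.lax _ (hY.dx_S h i), hdr hg]
    ring
  · intro i
    rw [hY.chi_eq h hab, act_adjDB hY.lax (hY.dx_S h i), d_neg_inv_mul, h.dr_sep_right hψ,
      h.dr_right hψ]
    ring
  · intro j
    obtain ⟨g, hg, hgj⟩ := hY.exists_chiStar_eq_darboux h j
    rw [hgj, d_darboux, adjAct_adjDB hY.lax, h.dr_right hg, h.dr_right hψ]
    simp only [← darbouxLin_apply, map_neg]
    ring
  · intro i j
    obtain ⟨g, hg, hgj⟩ := hY.exists_chiStar_eq_darboux h j
    obtain ⟨κ, hκ⟩ := hY.S_self hg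
    have h1 : X.chiStar b 1 = X.L.adjAct ψ - ∑ i, X.Ψ i * X.S (X.Φ i) ψ := by
      rw [chiStar_succ, hY.chiStar_zero, applyLStar]
    have hb := h.byParts i 0
    rw [h.dr_sep] at hb
    simp only [Hierarchy.sep, hY.chiStar_zero, zero_add] at hb
    have hb2 := h.byParts_right hg i
    rw [h.dr_sep_right hg, applyLStar] at hb2
    rw [h1] at hb
    rw [Hierarchy.sep, Hierarchy.sep, Hierarchy.sep, chiStar_succ, hgj, hY.applyLStar_eq h hg hκ,
      hY.chi_eq h hab, hY.chi_eq h hab, hY.S_eq hg, hY.S_eq hg, hdr hg, map_sub,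
      map_smul, hY.S_eq (X.applyLStar_mem_chiStarSpan b hg),
      hY.S_eq (X.chiStar_mem_chiStarSpan b 1), sum_eq_add_of_eq_off b _
      (fun c => (X.S (X.chi a i) (X.Ψ c) - X.Ψ c * (↑ψ⁻¹ : A) * X.S (X.chi a i) ψ) *
        (X.S (X.Φ c) g - g * (↑ψ⁻¹ : A) * X.S (X.Φ c) ψ))]
    · have hsum : ∑ c, (X.S (X.chi a i) (X.Ψ c) - X.Ψ c * (↑ψ⁻¹ : A) * X.S (X.chi a i) ψ) *
          (X.S (X.Φ c) g - g * (↑ψ⁻¹ : A) * X.S (X.Φ c) ψ) =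
          ∑ c, X.S (X.chi a i) (X.Ψ c) * X.S (X.Φ c) g -
          (↑ψ⁻¹ : A) * X.S (X.chi a i) ψ * ∑ c, X.Ψ c * X.S (X.Φ c) g -
          g * (↑ψ⁻¹ : A) * ∑ c, X.S (X.chi a i) (X.Ψ c) * X.S (X.Φ c) ψ +
          g * (↑ψ⁻¹ : A) * ((↑ψ⁻¹ : A) * X.S (X.chi a i) ψ) *
            ∑ c, X.Ψ c * X.S (X.Φ c) ψ := by
        simp only [Finset.mul_sum, ← Finset.sum_sub_distrib, ← Finset.sum_add_distrib]
        exact Finset.sum_congr rfl fun i _ => by ring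
      rw [hY.phi_self, hκ, hY.psi_self_eq, hY.S_eq (X.chiStar_mem_chiStarSpan b 1), hsum, h1,
        applyLStar, Algebra.smul_def]
      linear_combination hb2 - g * (↑ψ⁻¹ : A) * hb
    · intro c hc
      rw [hY.S_psi c hc, hY.phi_eq c hc, hY.S_eq hg]
      rfl
    · rw [← hY.unit_eq, Units.mul_inv, one_mul, sub_self, zero_mul]

end

end IsAdjDB

end Hierarchy

end KP

namespace KP

/-! ### Constrained KP hierarchies are coherent -/

variable {K A : Type*} [Field K] [CommRing A] [Algebra K A]

namespace PsiDO

variable {δ : Derivation K A A}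

theorem coeff_pos (P : PsiDO δ) (n : ℤ) : P.pos.coeff n = if 0 ≤ n then P.coeff n else 0 := rfl

theorem act_congr {P R : PsiDO δ} (h : ∀ i : ℕ, P.coeff i = R.coeff i) (f : A) :
    P.act f = R.act f := by
  simp only [act, h]

theorem adjAct_congr {P R : PsiDO δ} (h : ∀ i : ℕ, P.coeff i = R.coeff i) (f : A) :
    P.adjAct f = R.adjAct f := by
  simp only [adjAct, h]

theorem act_pos (P : PsiDO δ) (f : A) : P.pos.act f = P.act f :=
  act_congr (fun i => by simp [coeff_pos]) f

theorem adjAct_pos (P : PsiDO δ) (f : A) : P.pos.adjAct f = P.adjAct f :=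
  adjAct_congr (fun i => by simp [coeff_pos]) f

theorem act_sub_left (P R : PsiDO δ) (f : A) : (P - R).act f = P.act f - R.act f := by
  simp only [act_eq_res, sub_mul, res_sub]

theorem act_sum_left {ι : Type*} (s : Finset ι) (P : ι → PsiDO δ) (f : A) :
    (∑ i ∈ s, P i).act f = ∑ i ∈ s, (P i).act f := by
  classical
  induction s using Finset.induction_on with
  | empty => simp [act]
  | insert i s hi ih =>
    rw [Finset.sum_insert hi, Finset.sum_insert hi, ← ih]
    simp only [act_eq_res, add_mul, res_add]

theorem adjAct_sub_left (P R : PsiDO δ) (f : A) : (P - R).adjAct f = P.adjAct f - R.adjAct f := by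
  simp only [adjAct_eq_res, mul_sub, res_sub]

theorem adjAct_sum_left {ι : Type*} (s : Finset ι) (P : ι → PsiDO δ) (f : A) :
    (∑ i ∈ s, P i).adjAct f = ∑ i ∈ s, (P i).adjAct f := by
  classical
  induction s using Finset.induction_on with
  | empty => simp [adjAct]
  | insert i s hi ih =>
    rw [Finset.sum_insert hi, Finset.sum_insert hi, ← ih]
    simp only [adjAct_eq_res, mul_add, res_add]

theorem coeff_D_eq_zero {m i : ℤ} (h : m < i) : (D δ m).coeff i = 0 := if_neg (ne_of_gt h)

theorem coeff_C_eq_zero (f : A) {i : ℤ} (h : 0 < i) : (C δ f).coeff i = 0 := if_neg (ne_of_gt h)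

theorem coeff_D_neg_one_mul_C (g : A) {i : ℤ} (h : -1 < i) : (D δ (-1) * C δ g).coeff i = 0 :=
  coeff_mul_eq_zero (N := -1) (M := 0) (fun _ => coeff_D_eq_zero) (fun _ => coeff_C_eq_zero g)
    (by omega)

/-- The part with P_- has order at most -3 and therefore no residue. -/
theorem concomitant_pos (P : PsiDO δ) (f g : A) : P.pos.concomitant f g = P.concomitant f g := by
  rw [concomitant_eq_act, concomitant_eq_act, ← sub_eq_zero, ← act_sub_left, ← mul_sub, act_eq_res]
  refine coeff_mul_eq_zero (N := -2) (M := -1) (fun i hi => ?_) (fun _ => coeff_D_eq_zero)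
    (by norm_num)
  refine coeff_mul_eq_zero (N := -2) (M := 0) (fun i hi => ?_) (fun _ => coeff_C_eq_zero f)
    (by omega)
  refine coeff_mul_eq_zero (N := -1) (M := -1) (fun _ => coeff_D_neg_one_mul_C g) (fun i hi => ?_)
    (by omega)
  rw [coeff_sub, coeff_pos, if_pos (by omega), sub_self]

theorem concomitant_D_one (f g : A) : (D δ 1).concomitant f g = f * g := by
  have h : D δ (-1) * C δ g * D δ 1 = C δ g - D δ (-1) * C δ (δ g) := by
    rw [mul_assoc, eq_sub_iff_add_eq, ← mul_add, ← D_one_mul_C, ← mul_assoc,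
      D_neg_one_mul_D_one, one_mul]
  have h1 : (D δ (-1)).res = 1 := by simp [res, coeff_D]
  have h2 : (D δ (-1) * C δ (δ g) * C δ f * D δ (-1)).res = 0 := by
    rw [mul_assoc (D δ (-1)), ← C_mul]
    exact coeff_mul_eq_zero (N := -1) (M := -1) (fun _ => coeff_D_neg_one_mul_C _)
      (fun _ => coeff_D_eq_zero) (by norm_num)
  rw [concomitant, h, sub_mul, sub_mul, res_sub, h2, ← C_mul, res_C_mul, h1]
  ring

theorem coeff_support_finite (P : PsiDO δ) : {j : ℕ | P.coeff j ≠ 0}.Finite := by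
  obtain ⟨N, hN⟩ := P.bounded
  refine (Set.finite_Iic N.toNat).subset fun j hj => ?_
  have : (j : ℤ) ≤ N := not_lt.1 fun h => hj (hN _ h)
  simp only [Set.mem_Iic]
  omega

theorem act_support (P : PsiDO δ) (f : A) :
    (Function.support fun j : ℕ => P.coeff j * δ^[j] f).Finite :=
  P.coeff_support_finite.subset fun j hj h => hj (by simp [h])

theorem adjAct_support (P : PsiDO δ) (f : A) :
    (Function.support fun j : ℕ => (-1) ^ j * δ^[j] (P.coeff j * f)).Finite :=
  P.coeff_support_finite.subset fun j hj h => hj (by simp [h])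

end PsiDO

namespace Hierarchy

open PsiDO

variable {t : Times K A} {m : ℕ} {X : Hierarchy t m} {r : ℕ+} {a b : Fin m} {Q : PsiDO (t.d 1)}

local notation "∂⁻¹" => D (t.d 1) (-1)
local notation "𝐜" => C (t.d 1)

/-- Since f ψ = s', integration by parts turns D⁻¹ (ψ f) D⁻¹ into s D⁻¹ - D⁻¹ s. -/
theorem act_mul_C_D_C (P : PsiDO (t.d 1)) (φ ψ : A) {f s : A} (hs : t.d 1 s = f * ψ) :
    (P * (𝐜 φ * ∂⁻¹ * 𝐜 ψ)).act f = P.act (φ * s) - P.act φ * s := by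
  have h : P * (𝐜 φ * ∂⁻¹ * 𝐜 ψ) * 𝐜 f * ∂⁻¹ =
      P * 𝐜 (φ * s) * ∂⁻¹ - P * 𝐜 φ * ∂⁻¹ * 𝐜 s := by
    have := D_neg_one_mul_C_mul_D_neg_one (δ := t.d 1) s
    rw [hs, mul_comm f, C_mul] at this
    calc _ = P * 𝐜 φ * (∂⁻¹ * (𝐜 ψ * 𝐜 f) * ∂⁻¹) := by simp only [mul_assoc]
      _ = _ := by rw [this, mul_sub, C_mul]; simp only [mul_assoc]
  rw [act_eq_res, h, res_sub, res_mul_C, ← act_eq_res, ← act_eq_res]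

theorem act_C_D_C_mul (P : PsiDO (t.d 1)) (φ ψ f : A) :
    ((𝐜 φ * ∂⁻¹ * 𝐜 ψ) * P).act f = φ * P.concomitant f ψ := by
  rw [act_eq_res, concomitant, ← res_C_mul]
  simp only [mul_assoc]

theorem adjAct_C_D_C_mul (P : PsiDO (t.d 1)) (φ ψ : A) {g s : A} (hs : t.d 1 s = φ * g) :
    ((𝐜 φ * ∂⁻¹ * 𝐜 ψ) * P).adjAct g = s * P.adjAct ψ - P.adjAct (ψ * s) := by
  have h : ∂⁻¹ * 𝐜 g * ((𝐜 φ * ∂⁻¹ * 𝐜 ψ) * P) =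
      𝐜 s * (∂⁻¹ * 𝐜 ψ * P) - ∂⁻¹ * 𝐜 (ψ * s) * P := by
    have := D_neg_one_mul_C_mul_D_neg_one (δ := t.d 1) s
    rw [hs, mul_comm φ, C_mul] at this
    calc _ = (∂⁻¹ * (𝐜 g * 𝐜 φ) * ∂⁻¹) * (𝐜 ψ * P) := by simp only [mul_assoc]
      _ = _ := by rw [this, sub_mul, mul_comm ψ, C_mul]; simp only [mul_assoc]
  rw [adjAct_eq_res, h, res_sub, res_C_mul, ← adjAct_eq_res, ← adjAct_eq_res]

theorem adjAct_mul_C_D_C (P : PsiDO (t.d 1)) (φ ψ g : A) :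
    (P * (𝐜 φ * ∂⁻¹ * 𝐜 ψ)).adjAct g = P.concomitant φ g * ψ := by
  rw [adjAct_eq_res, concomitant, ← res_mul_C]
  simp only [mul_assoc]

theorem d_iterate (k : ℕ+) (j : ℕ) (f : A) : t.d k ((t.d 1)^[j] f) = (t.d 1)^[j] (t.d k f) := by
  induction j generalizing f with
  | zero => rfl
  | succ j ih => rw [Function.iterate_succ_apply, ih, t.comm, Function.iterate_succ_apply]

theorem d_act (k : ℕ+) {P R : PsiDO (t.d 1)} (hR : ∀ i : ℕ, t.d k (P.coeff i) = R.coeff i)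
    (f : A) : t.d k (P.act f) = R.act f + P.act (t.d k f) := by
  have e : ∀ x, t.d k x = (t.d k : A →ₗ[K] A).toAddMonoidHom x := fun _ => rfl
  rw [act, e, AddMonoidHom.map_finsum _ (P.act_support f), act, act,
    ← finsum_add_distrib (R.act_support f) (P.act_support _)]
  refine finsum_congr fun j => ?_
  rw [← e, Derivation.leibniz, d_iterate, hR, smul_eq_mul, smul_eq_mul]
  ring

theorem d_adjAct (k : ℕ+) {P R : PsiDO (t.d 1)} (hR : ∀ i : ℕ, t.d k (P.coeff i) = R.coeff i)
    (f : A) : t.d k (P.adjAct f) = R.adjAct f + P.adjAct (t.d k f) := by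
  have e : ∀ x, t.d k x = (t.d k : A →ₗ[K] A).toAddMonoidHom x := fun _ => rfl
  rw [adjAct, e, AddMonoidHom.map_finsum _ (P.adjAct_support f), adjAct, adjAct,
    ← finsum_add_distrib (R.adjAct_support f) (P.adjAct_support _)]
  refine finsum_congr fun j => ?_
  have e2 : t.d k ((-1) ^ j) = 0 := by simp
  rw [← e, Derivation.leibniz, d_iterate, e2, Derivation.leibniz, hR, smul_eq_mul, smul_eq_mul,
    smul_zero, add_zero, smul_eq_mul, ← mul_add, ← iterate_map_add, add_comm, mul_comm f]

theorem act_fintypeSum {ι : Type*} [Fintype ι] (P : PsiDO (t.d 1)) (F : ι → A) :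
    P.act (∑ i, F i) = ∑ i, P.act (F i) := map_sum P.actLin F _

theorem adjAct_fintypeSum {ι : Type*} [Fintype ι] (P : PsiDO (t.d 1)) (F : ι → A) :
    P.adjAct (∑ i, F i) = ∑ i, P.adjAct (F i) := map_sum P.adjActLin F _

namespace IsCKP

variable (hX : X.IsCKP r Q)
include hX

theorem pos_add_sum : X.L = X.L.pos + ∑ c, 𝐜 (X.Φ c) * ∂⁻¹ * 𝐜 (X.Ψ c) := by
  have hsum : ∀ (s : Finset (Fin m)) (n : ℤ), (∑ c ∈ s, 𝐜 (X.Φ c) * ∂⁻¹ * 𝐜 (X.Ψ c)).coeff n =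
      ∑ c ∈ s, (𝐜 (X.Φ c) * ∂⁻¹ * 𝐜 (X.Ψ c)).coeff n := by
    intro s n
    induction s using Finset.induction_on with
    | empty => simp
    | insert i s hi ih => rw [Finset.sum_insert hi, Finset.sum_insert hi, coeff_add, ih]
  refine ext_coeff fun n => ?_
  rw [coeff_add, coeff_pos, hsum]
  split_ifs with h
  · rw [Finset.sum_eq_zero, add_zero]
    intro c _
    rw [mul_assoc, coeff_C_mul, coeff_D_neg_one_mul_C _ (by omega), mul_zero]
  · rw [zero_add, hX.negPart n (not_le.1 h)]

/-- For n = r the Lax equation reads ∂L/∂t_r = [L_+, L] = [L_+, L_-], and L_- is the explicit finite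
sum. -/
theorem lax_eq (i : ℕ) : t.d r (X.L.coeff i) =
    ((∑ c, X.L.pos * (𝐜 (X.Φ c) * ∂⁻¹ * 𝐜 (X.Ψ c))) -
      ∑ c, (𝐜 (X.Φ c) * ∂⁻¹ * 𝐜 (X.Ψ c)) * X.L.pos).coeff i := by
  rw [hX.lax, hX.root_pow, ← coeff_sub, ← Finset.mul_sum, ← Finset.sum_mul]
  congr 1
  have h := hX.pos_add_sum
  generalize X.L.pos = P at h
  rw [h]
  noncomm_ring

theorem d_act_L {f : A} {s : Fin m → A} (hs : ∀ c, t.d 1 (s c) = f * X.Ψ c) :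
    t.d r (X.L.act f) = ∑ c, (X.L.act (X.Φ c * s c) - X.L.act (X.Φ c) * s c -
      X.Φ c * X.L.concomitant f (X.Ψ c)) + X.L.act (t.d r f) := by
  rw [d_act r hX.lax_eq, act_sub_left, act_sum_left, act_sum_left, ← Finset.sum_sub_distrib]
  congr 1
  refine Finset.sum_congr rfl fun c _ => ?_
  rw [act_mul_C_D_C _ _ _ (hs c), act_C_D_C_mul, act_pos, act_pos, concomitant_pos]

theorem d_adjAct_L {g : A} {s : Fin m → A} (hs : ∀ c, t.d 1 (s c) = X.Φ c * g) :
    t.d r (X.L.adjAct g) = ∑ c, (X.L.concomitant (X.Φ c) g * X.Ψ c -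
      (s c * X.L.adjAct (X.Ψ c) - X.L.adjAct (X.Ψ c * s c))) + X.L.adjAct (t.d r g) := by
  rw [d_adjAct r hX.lax_eq, adjAct_sub_left, adjAct_sum_left, adjAct_sum_left,
    ← Finset.sum_sub_distrib]
  congr 1
  refine Finset.sum_congr rfl fun c _ => ?_
  rw [adjAct_C_D_C_mul _ _ _ (hs c), adjAct_mul_C_D_C, adjAct_pos, adjAct_pos, concomitant_pos]

theorem root_pos : (Q.pow (1 : ℕ+)).pos = D (t.d 1) 1 := by
  have h : Q.pow (1 : ℕ+) = Q := one_mul Q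
  refine ext_coeff fun n => ?_
  rw [h, coeff_pos, coeff_D]
  rcases lt_trichotomy n 0 with h0 | rfl | h0
  · rw [if_neg (by omega), if_neg (by omega)]
  · rw [hX.root_zero]
    simp
  · rcases (show 1 = n ∨ 1 < n by omega) with rfl | h1
    · rw [hX.root_one]
      simp
    · rw [hX.root_top n h1, if_neg (by omega : ¬ n = 1), ite_self]

variable (hS : X.IsSEP r Q a b)
include hS

/-- The flow t_1 gives the x-derivatives of the potentials, since (L^{1/r})_+ = D, and the flow t_r
gives their concomitants. That L^i(Φ_a) remains an eigenfunction for t_r follows by induction: the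
commutator terms in ∂L_+/∂t_r cancel against the derivatives of Φ_c and S(f, Ψ_c). The adjoint side
is analogous. -/
theorem isCoherent : X.IsCoherent r a b := by
  have hdx : ∀ c e i j, t.d 1 (X.sep c e i j) = X.chi c i * X.chiStar e j := by
    intro c e i j
    rw [hS.flow, hX.root_pos]
    exact concomitant_D_one _ _
  have hdr : ∀ c e i j, t.d r (X.sep c e i j) =
      X.L.concomitant (X.chi c i) (X.chiStar e j) := by
    intro c e i j
    rw [hS.flow, hX.root_pow]
    exact concomitant_pos _ _ _
  have hPhi : ∀ c, t.d r (X.Φ c) = X.L.act (X.Φ c) := fun c => by rw [hX.eigen, hX.root_pow]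
  have hPsi : ∀ c, t.d r (X.Ψ c) = -X.L.adjAct (X.Ψ c) := fun c => by
    rw [hX.adjEigen, hX.root_pow]
  refine ⟨fun i c => hdx a c i 0, fun c j => hdx c b 0 j, hdx a b, hdr a b, fun i => ?_,
    fun j => ?_, hS.byParts⟩
  · induction i with
    | zero => exact hPhi a
    | succ i ih =>
      have h1 : ∀ c, t.d r (X.S (X.chi a i) (X.Ψ c)) =
        X.L.concomitant (X.chi a i) (X.Ψ c) := fun c => hdr a c i 0
      rw [chi_succ, applyL, map_add, hX.d_act_L (fun c => hdx a c i 0), map_sum, ih, act_add,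
        act_fintypeSum, add_right_comm, ← Finset.sum_add_distrib, add_comm]
      refine congrArg _ (Finset.sum_congr rfl fun c _ => ?_)
      rw [Derivation.leibniz, h1, hPhi, smul_eq_mul, smul_eq_mul]
      change X.L.act (X.Φ c * X.S (X.chi a i) (X.Ψ c)) - X.L.act (X.Φ c) *
        X.S (X.chi a i) (X.Ψ c) - _ + _ = _
      ring
  · induction j with
    | zero => exact hPsi b
    | succ j ih =>
      have h1 : ∀ c, t.d r (X.S (X.Φ c) (X.chiStar b j)) =
        X.L.concomitant (X.Φ c) (X.chiStar b j) := fun c => hdr c b 0 j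
      have e : X.L.adjAct (X.applyLStar (X.chiStar b j)) =
          X.L.adjAct (X.L.adjAct (X.chiStar b j)) -
          ∑ c, X.L.adjAct (X.Ψ c * X.S (X.Φ c) (X.chiStar b j)) := by
        rw [applyLStar, ← adjAct_fintypeSum]
        exact map_sub X.L.adjActLin _ _
      have e2 : X.L.adjAct (-X.L.adjAct (X.chiStar b j)) =
        -X.L.adjAct (X.L.adjAct (X.chiStar b j)) := map_neg X.L.adjActLin _
      rw [chiStar_succ, e, applyLStar, map_sub, hX.d_adjAct_L (fun c => hdx c b 0 j), map_sum, ih,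
        e2, neg_sub, add_sub_right_comm, ← Finset.sum_sub_distrib, ← sub_eq_add_neg]
      refine congrArg (· - _) (Finset.sum_congr rfl fun c _ => ?_)
      rw [Derivation.leibniz, h1, hPsi, smul_eq_mul, smul_eq_mul]
      change _ - (X.S (X.Φ c) (X.chiStar b j) * _ -
        X.L.adjAct (X.Ψ c * X.S (X.Φ c) (X.chiStar b j))) - _ = _
      ring

end IsCKP

end Hierarchy

end KP

namespace KP

variable {K A : Type*} [Field K] [CommRing A] [Algebra K A]

/-! ### Determinants under triangular changes of rows -/

/-- `N` is a lower triangular matrix with diagonal `c` times `M`. All row reductions below are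
stated as membership in spans of earlier rows, so the off-diagonal coefficients need not be
computed. -/
theorem det_eq_prod_mul_det_of_sub_mem_span {n : ℕ} {M N : Matrix (Fin n) (Fin n) A} (c : Fin n → A)
    (h : ∀ i, N i - c i • M i ∈ Submodule.span A (M '' Set.Iio i)) :
    N.det = (∏ i, c i) * M.det := by
  have h2 : ∀ i, ∃ v : Fin n → A, (∀ j, i ≤ j → v j = 0) ∧ N i - c i • M i = ∑ j, v j • M j := by
    intro i
    obtain ⟨v, hv, hsum⟩ := (Finsupp.mem_span_image_iff_linearCombination A).1 (h i)
    refine ⟨v, fun j hj => ?_, ?_⟩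
    · by_contra hne
      exact absurd ((Finsupp.mem_supported _ _).1 hv (by simpa using hne)) (not_lt.2 hj)
    · exact hsum.symm.trans ((Finsupp.linearCombination_apply A v).trans
        (Finsupp.sum_fintype _ _ (by simp)))
  choose v hv hsum using h2
  let V : Matrix (Fin n) (Fin n) A := Matrix.of fun i j => if i = j then c i else v i j
  have hN : N = V * M := by
    ext i l
    have := congrFun (hsum i) l
    simp only [Pi.sub_apply, Pi.smul_apply, smul_eq_mul, Finset.sum_apply] at this
    rw [sub_eq_iff_eq_add.1 this, Matrix.mul_apply,
      ← Finset.add_sum_erase _ (fun j => V i j * M j l) (Finset.mem_univ i),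
      ← Finset.add_sum_erase _ (fun j => v i j * M j l) (Finset.mem_univ i), hv i i le_rfl,
      zero_mul, zero_add, add_comm]
    refine congrArg₂ (· + ·) (by simp [V]) (Finset.sum_congr rfl fun j hj => ?_)
    simp [V, (Finset.ne_of_mem_erase hj).symm]
  have hV : V.BlockTriangular OrderDual.toDual := by
    intro i j hij
    have hij : i < j := hij
    simp [V, hij.ne, hv i j hij.le]
  rw [hN, Matrix.det_mul, Matrix.det_of_isLowerTriangular V hV]
  simp [V]

/-! ### Differentiating along a flag of spans. -/

section Deriv

variable {ι : Type*} (δ : Derivation K A A) (x : ℕ → ι → A) (e : ℕ → A)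
  (hx : ∀ m, (fun i => δ (x m i)) - e m • x (m + 1) ∈ Submodule.span A (x '' Set.Iio (m + 1)))
include hx

theorem deriv_mem_span (d : ℕ) {z : ι → A} (hz : z ∈ Submodule.span A (x '' Set.Iio d)) :
    (fun i => δ (z i)) ∈ Submodule.span A (x '' Set.Iio (d + 1)) := by
  have hmono : Submodule.span A (x '' Set.Iio d) ≤ Submodule.span A (x '' Set.Iio (d + 1)) :=
    Submodule.span_mono (Set.image_mono (Set.Iio_subset_Iio d.le_succ))
  induction hz using Submodule.span_induction with
  | mem z hz =>
    obtain ⟨m, hm, rfl⟩ := hz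
    rw [← sub_add_cancel (fun i => δ (x m i)) (e m • x (m + 1))]
    exact Submodule.add_mem _
      (Submodule.span_mono (Set.image_mono (Set.Iio_subset_Iio (Nat.succ_le_succ hm.le))) (hx m))
      (Submodule.smul_mem _ _ (Submodule.subset_span ⟨m + 1, Nat.succ_lt_succ hm, rfl⟩))
  | zero =>
    have : (fun i => δ ((0 : ι → A) i)) = 0 := funext fun i => map_zero δ
    rw [this]
    exact Submodule.zero_mem _
  | add y z _ _ hy hz =>
    have : (fun i => δ ((y + z) i)) = (fun i => δ (y i)) + fun i => δ (z i) :=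
      funext fun i => map_add δ _ _
    rw [this]
    exact Submodule.add_mem _ hy hz
  | smul a z hz' hz =>
    have : (fun i => δ ((a • z) i)) = a • (fun i => δ (z i)) + δ a • z :=
      funext fun i => by simp [Derivation.leibniz, mul_comm]
    rw [this]
    exact Submodule.add_mem _ (Submodule.smul_mem _ _ hz) (Submodule.smul_mem _ _ (hmono hz'))

theorem iterate_deriv_sub_mem_span {y : ι → A} {d : ℕ} {c : A}
    (hy : y - c • x d ∈ Submodule.span A (x '' Set.Iio d)) (l : ℕ) :
    (fun i => δ^[l] (y i)) - (c * ∏ m ∈ Finset.range l, e (d + m)) • x (d + l) ∈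
      Submodule.span A (x '' Set.Iio (d + l)) := by
  induction l with
  | zero => simpa using hy
  | succ l ih =>
    set c' := c * ∏ m ∈ Finset.range l, e (d + m)
    -- Differentiating the leading term produces δ(c') times the old vector, which is now of lower
    -- order, and c' times the next vector with factor `e (d + l)`.
    have h := Submodule.add_mem _ (Submodule.add_mem _ (deriv_mem_span δ x e hx _ ih)
      (Submodule.smul_mem _ (δ c') (Submodule.subset_span
        (⟨d + l, Nat.lt_succ_self _, rfl⟩ : x (d + l) ∈ x '' Set.Iio (d + l + 1)))))
      (Submodule.smul_mem _ c' (hx (d + l)))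
    rw [← add_assoc d l 1]
    convert h using 1
    funext i
    simp only [Function.iterate_succ_apply', Pi.sub_apply, Pi.smul_apply, Pi.add_apply, map_sub,
      smul_eq_mul, Derivation.leibniz, Finset.prod_range_succ, c']
    ring

end Deriv

/-- Functions `f_i`, `g_j` together with potentials `S_{ij}` of the products `f_i g_j`. -/
structure SepData (A : Type*) where
  f : ℕ → A
  g : ℕ → A
  S : ℕ → ℕ → A

namespace SepData

/-- Exchange of the roles of `f` and `g`. -/
def swap (d : SepData A) : SepData A := ⟨d.g, d.f, fun i j => d.S j i⟩

variable (δ : Derivation K A A)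

/-- `S_{ij}` is a potential of `f_i g_j`. -/
def IsSep (d : SepData A) : Prop := ∀ i j, δ (d.S i j) = d.f i * d.g j

/-- The effect of a Darboux–Bäcklund transformation, up to a unitriangular change of the `f_i` with
constant coefficients. -/
structure IsStep (φ : Aˣ) (d d' : SepData A) : Prop where
  unit_eq : (φ : A) = d.f 0
  g_eq : ∀ j, d'.g j = -(↑φ⁻¹ * d.S 0 j)
  exists_eq : ∀ i, ∃ u : ℕ → K, u i = 1 ∧
    d'.f i = ∑ l ∈ Finset.range (i + 1), u l • (φ * δ (↑φ⁻¹ * d.f (l + 1))) ∧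
    ∀ j, d'.S i j = ∑ l ∈ Finset.range (i + 1),
      u l • (d.S (l + 1) j - d.f (l + 1) * ↑φ⁻¹ * d.S 0 j)

/-- The matrix with rows `(S_{ij})_i`, `j < k`, followed by the rows `(δ^l f_i)_i`, `l < n - k`. -/
def mat (d : SepData A) (n k : ℕ) : Matrix (Fin n) (Fin n) A :=
  Matrix.of fun j i => if (j : ℕ) < k then d.S i j else δ^[(j : ℕ) - k] (d.f i)

theorem det_mat_swap (d : SepData A) (n : ℕ) : (d.swap.mat δ n n).det = (d.mat δ n n).det := by
  rw [← Matrix.det_transpose]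
  congr 1
  ext i j
  simp [mat, swap]

variable {δ} {φ : Aˣ} {d d' : SepData A}

theorem IsSep.swap (hd : d.IsSep δ) : d.swap.IsSep δ := fun i j => (hd j i).trans (mul_comm _ _)

theorem IsStep.isSep (hd : d.IsSep δ) (h : IsStep δ φ d d') : d'.IsSep δ := by
  intro i j
  obtain ⟨u, -, hf, hS⟩ := h.exists_eq i
  rw [hS, hf, h.g_eq, map_sum, Finset.sum_mul]
  refine Finset.sum_congr rfl fun l _ => ?_
  rw [δ.map_smul, smul_mul_assoc, mul_comm (d.f (l + 1)), map_sub, hd, Derivation.leibniz, hd,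
    ← h.unit_eq, smul_eq_mul, smul_eq_mul]
  congr 1
  linear_combination (d.S 0 j * δ (↑φ⁻¹ * d.f (l + 1)) - d.f (l + 1) * d.g j) * φ.mul_inv

/-- The transformed matrix without the unitriangular change. -/
def stepMat (δ : Derivation K A A) (φ : Aˣ) (d : SepData A) (n k : ℕ) : Matrix (Fin n) (Fin n) A :=
  Matrix.of fun j i => if (j : ℕ) < k then d.S (i + 1) j - d.f (i + 1) * ↑φ⁻¹ * d.S 0 j
    else δ^[(j : ℕ) - k] (φ * δ (↑φ⁻¹ * d.f (i + 1)))

/-- The unitriangular change acts on the index of f, that is on the columns, hence the transposes.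
Its coefficients are constants, so they pass through δ^l. -/
theorem IsStep.det_mat (h : IsStep δ φ d d') (n k : ℕ) :
    (d'.mat δ n k).det = (stepMat δ φ d n k).det := by
  rw [← Matrix.det_transpose, ← Matrix.det_transpose (stepMat δ φ d n k),
    det_eq_prod_mul_det_of_sub_mem_span (M := (stepMat δ φ d n k).transpose) (fun _ => 1)]
  · simp
  intro i
  obtain ⟨u, hu, hf, hS⟩ := h.exists_eq i
  have e : (d'.mat δ n k).transpose i - (1 : A) • (stepMat δ φ d n k).transpose i =
      ∑ l : Fin i, (algebraMap K A (u l)) •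
        (stepMat δ φ d n k).transpose (Fin.castLE i.2.le l) := by
    funext j
    have hi : u i • (stepMat δ φ d n k).transpose i j = (stepMat δ φ d n k).transpose i j := by
      rw [hu, one_smul]
    have hsum : (d'.mat δ n k).transpose i j =
        ∑ l : Fin (i + 1), u l • (stepMat δ φ d n k).transpose (Fin.castLE i.2 l) j := by
      simp only [Matrix.transpose_apply, mat, stepMat, Matrix.of_apply, Fin.val_castLE]
      by_cases hj : (j : ℕ) < k
      · simp only [if_pos hj, hS, Finset.sum_range]
      · simp only [if_neg hj, hf, ← iterate_derivation_smul, Finset.sum_range]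
        exact Finset.sum_hom_rel (r := fun x y => δ^[(j : ℕ) - k] x = y) (by simp)
          fun l x y h => by rw [iterate_map_add, h]
    rw [one_smul, Pi.sub_apply, hsum, Fin.sum_univ_castSucc, Finset.sum_apply]
    have hlast : Fin.castLE i.2 (Fin.last (i : ℕ)) = i := rfl
    rw [hlast, Fin.val_last, hi, add_sub_cancel_right]
    exact Finset.sum_congr rfl fun l _ => by
      rw [Pi.smul_apply, algebraMap_smul]
      rfl
  rw [e]
  refine Submodule.sum_mem _ fun l _ => Submodule.smul_mem _ _ (Submodule.subset_span ⟨_, ?_, rfl⟩)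
  exact l.2

theorem det_eq_of_forall_succ_eq_zero {n : ℕ} (B : Matrix (Fin (n + 1)) (Fin (n + 1)) A)
    (h : ∀ j : Fin n, B j.succ 0 = 0) : B.det = B 0 0 * (B.submatrix Fin.succ Fin.succ).det := by
  rw [Matrix.det_succ_column_zero, Fin.sum_univ_succ, Finset.sum_eq_zero, add_zero]
  · simp
  · intro j _
    rw [h, mul_zero, zero_mul]

/-- Move row `k` to the top. -/
def cycle {R : Type*} {n : ℕ} (M : Matrix (Fin (n + 1)) (Fin (n + 1)) R) (k : Fin (n + 1)) :
    Matrix (Fin (n + 1)) (Fin (n + 1)) R := M.submatrix k.cycleRange.symm id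

section cycle

variable {R : Type*} {n : ℕ} (M : Matrix (Fin (n + 1)) (Fin (n + 1)) R) (k : Fin (n + 1))

theorem cycle_zero : cycle M k 0 = M k := by
  funext i
  rw [cycle, Matrix.submatrix_apply, Fin.cycleRange_symm_zero, id]

theorem cycle_succ_of_lt {j : Fin n} (h : (j : ℕ) < k) : cycle M k j.succ = M j.castSucc := by
  funext i
  rw [cycle, Matrix.submatrix_apply, Fin.cycleRange_symm_succ,
    Fin.succAbove_of_castSucc_lt _ _ (by exact h), id]

theorem cycle_succ_of_le {j : Fin n} (h : (k : ℕ) ≤ j) : cycle M k j.succ = M j.succ := by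
  funext i
  rw [cycle, Matrix.submatrix_apply, Fin.cycleRange_symm_succ,
    Fin.succAbove_of_le_castSucc _ _ (by exact h), id]

end cycle

theorem det_cycle {n : ℕ} (M : Matrix (Fin (n + 1)) (Fin (n + 1)) A) (k : Fin (n + 1)) :
    (cycle M k).det = (-1) ^ (k : ℕ) * M.det := by
  rw [cycle, Matrix.det_permute, ← Equiv.Perm.inv_def, Equiv.Perm.sign_inv, Fin.sign_cycleRange]
  simp

theorem det_eq_cycle {n : ℕ} (M : Matrix (Fin (n + 1)) (Fin (n + 1)) A) (k : Fin (n + 1)) :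
    M.det = (-1) ^ (k : ℕ) * (cycle M k).det := by
  rw [det_cycle, ← mul_assoc, ← mul_pow, neg_one_mul, neg_neg, one_pow, one_mul]

/-- The row f_i is moved to the top, which gives the sign. Subtracting multiples of the rows above
turns S_{ij} into S_{ij} - f_i S_{0j}/φ and the derivatives of f_i into those of φ δ(f_i/φ). Both
vanish at i = 0, so column 0 is (φ, 0, …, 0) and the minor is the transformed matrix. -/
theorem IsStep.det_mat_succ (h : IsStep δ φ d d') {n k : ℕ} (hk : k ≤ n) :
    (d.mat δ (n + 1) k).det = (-1) ^ k * (φ * (d'.mat δ n k).det) := by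
  let κ : Fin (n + 1) := ⟨k, Nat.lt_succ_of_le hk⟩
  -- The matrix after row reduction, with the row f_i on top.
  let B : Matrix (Fin (n + 1)) (Fin (n + 1)) A := Matrix.of (Fin.cons (fun i => d.f i)
    fun j i => if (j : ℕ) < k then d.S i j - d.f i * ↑φ⁻¹ * d.S 0 j
      else δ^[(j : ℕ) - k] (φ * δ (↑φ⁻¹ * d.f i)))
  have h0 : cycle (d.mat δ (n + 1) k) κ 0 = fun i : Fin (n + 1) => d.f i := by
    rw [cycle_zero]
    funext i
    simp [mat, κ]
  have hle : ∀ j : Fin n, k ≤ j → cycle (d.mat δ (n + 1) k) κ j.succ =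
      fun i : Fin (n + 1) => δ^[(j : ℕ) + 1 - k] (d.f i) := by
    intro j hj
    rw [cycle_succ_of_le (d.mat δ (n + 1) k) κ (j := j) hj]
    funext i
    simp [mat, show ¬ (j : ℕ) + 1 < k by omega]
  have hB : B.det = (cycle (d.mat δ (n + 1) k) κ).det := by
    rw [det_eq_prod_mul_det_of_sub_mem_span (M := cycle (d.mat δ (n + 1) k) κ) fun _ => 1]
    · simp
    intro i
    refine Fin.cases ?_ (fun j => ?_) i
    · rw [one_smul, h0]
      have hB0 : B 0 = fun i : Fin (n + 1) => d.f i := rfl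
      rw [hB0, sub_self]
      exact Submodule.zero_mem _
    rw [one_smul]
    by_cases hj : (j : ℕ) < k
    · have e : B j.succ - cycle (d.mat δ (n + 1) k) κ j.succ =
          (-(↑φ⁻¹ * d.S 0 j)) • cycle (d.mat δ (n + 1) k) κ 0 := by
        rw [h0, cycle_succ_of_lt (d.mat δ (n + 1) k) κ (j := j) hj]
        funext i
        simp only [B, mat, Matrix.of_apply, Fin.cons_succ, Pi.sub_apply, Pi.smul_apply, if_pos hj,
          Fin.val_castSucc, smul_eq_mul]
        ring
      rw [e]
      exact Submodule.smul_mem _ _ (Submodule.subset_span ⟨0, Fin.succ_pos j, rfl⟩)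
    · have hj := not_lt.1 hj
      let x : ℕ → Fin (n + 1) → A := fun m i => δ^[m] (d.f i)
      have hy : (fun i : Fin (n + 1) => (φ : A) * δ (↑φ⁻¹ * d.f i)) - (1 : A) • x 1 ∈
          Submodule.span A (x '' Set.Iio 1) := by
        have e : (fun i : Fin (n + 1) => (φ : A) * δ (↑φ⁻¹ * d.f i)) - (1 : A) • x 1 =
            ((φ : A) * δ (↑φ⁻¹ : A)) • x 0 := by
          funext i
          simp only [x, Pi.sub_apply, Pi.smul_apply, Function.iterate_one, Function.iterate_zero,
            id, smul_eq_mul, Derivation.leibniz]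
          linear_combination (δ (d.f i)) * φ.mul_inv
        rw [e]
        exact Submodule.smul_mem _ _ (Submodule.subset_span ⟨0, Nat.one_pos, rfl⟩)
      have := iterate_deriv_sub_mem_span δ x (fun _ => 1) (fun m => by
        convert Submodule.zero_mem _ using 1
        funext i
        simp [x, Function.iterate_succ_apply']) hy (j - k)
      rw [Finset.prod_const_one, mul_one, one_smul] at this
      have e : (fun i : Fin (n + 1) => δ^[(j : ℕ) - k] ((φ : A) * δ (↑φ⁻¹ * d.f i))) = B j.succ := by
        funext i
        simp [B, not_lt.2 hj]
      have e2 : x (1 + (j - k)) = cycle (d.mat δ (n + 1) k) κ j.succ := by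
        rw [hle j hj, show (j : ℕ) + 1 - k = 1 + (j - k) by omega]
      rw [← e, ← e2]
      refine Submodule.span_le.2 ?_ this
      rintro _ ⟨m, hm, rfl⟩
      have hm : m < 1 + (j - k) := hm
      rcases m with _ | m
      · exact Submodule.subset_span ⟨0, Fin.succ_pos j, h0⟩
      · refine Submodule.subset_span ⟨(⟨k + m, by omega⟩ : Fin n).succ, ?_, ?_⟩
        · rw [Set.mem_Iio, Fin.succ_lt_succ_iff, Fin.lt_def]
          simp only
          omega
        · rw [hle _ (by simp), show ((⟨k + m, by omega⟩ : Fin n) : ℕ) + 1 - k = m + 1 by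
            simp only; omega]
  have hsub : B.submatrix Fin.succ Fin.succ = stepMat δ φ d n k := by
    ext j i
    simp [B, stepMat]
  rw [det_eq_cycle _ κ, ← hB, det_eq_of_forall_succ_eq_zero, hsub, h.det_mat]
  · simp [B, κ, h.unit_eq]
  · intro j
    simp only [B, Matrix.of_apply, Fin.cons_succ, Fin.val_zero, ← h.unit_eq, Units.inv_mul,
      Units.mul_inv, one_mul, sub_self, Derivation.map_one_eq_zero, mul_zero, iterate_map_zero,
      ite_self]

/-- No change of size occurs here. With the row -S_{0i}/φ on top, the transformed potentials reduce
to S_{j+1,i} modulo earlier rows, and δ^{l+1}(-S_{0i}/φ) reduces to -δ^l g_i because δS_{0i} = φ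
g_i. -/
theorem IsStep.det_swap_mat (hd : d.IsSep δ) (h : IsStep δ φ d d') {n k : ℕ} (hk : n + 1 ≤ k) :
    φ * (d'.swap.mat δ k n).det = (-1) ^ k * (d.swap.mat δ k (n + 1)).det := by
  obtain ⟨k, rfl⟩ : ∃ k', k = k' + 1 := ⟨k - 1, by omega⟩
  let ν : Fin (k + 1) := ⟨n, by omega⟩
  let M := d.swap.mat δ (k + 1) (n + 1)
  -- The flag S_0, g, δg, …: the first differentiation contributes the factor φ, later ones 1, so
  -- the leading coefficient is -φ⁻¹ at first and -1 from then on.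
  let x : ℕ → Fin (k + 1) → A := fun m i => Nat.casesOn m (d.S 0 i) fun l => δ^[l] (d.g i)
  let e : ℕ → A := fun m => Nat.casesOn m φ fun _ => 1
  let c : ℕ → A := fun l => -↑φ⁻¹ * ∏ m ∈ Finset.range l, e (0 + m)
  have hx : ∀ m, (fun i => δ (x m i)) - e m • x (m + 1) ∈
      Submodule.span A (x '' Set.Iio (m + 1)) := by
    intro m
    convert Submodule.zero_mem _ using 1
    funext i
    rcases m with _ | m
    · exact sub_eq_zero.2 ((hd 0 i).trans (by rw [← h.unit_eq]; rfl))
    · simp [x, e, Function.iterate_succ_apply']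
  have hspan : ∀ l, (fun i : Fin (k + 1) => δ^[l] (-(↑φ⁻¹ * d.S 0 i))) - c l • x l ∈
      Submodule.span A (x '' Set.Iio l) := by
    intro l
    have := iterate_deriv_sub_mem_span δ x e hx (d := 0) (c := -↑φ⁻¹)
      (y := fun i => -(↑φ⁻¹ * d.S 0 i)) (by
        convert Submodule.zero_mem _ using 1
        funext i
        simp [x]) l
    simpa only [zero_add, c] using this
  have hc : ∀ l, c (l + 1) = -1 := by
    intro l
    simp only [c, Finset.prod_range_succ', zero_add]
    simp [e]
  have hM0 : M 0 = x 0 := by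
    funext i
    simp [M, mat, swap, x]
  have hMx : ∀ (l : ℕ) (hl : n + l + 1 < k + 1), M ⟨n + l + 1, hl⟩ = x (l + 1) := by
    intro l hl
    funext i
    have e2 : n + l + 1 - (n + 1) = l := by omega
    simp [M, mat, swap, x, e2]
  have key : (cycle (d'.swap.mat δ (k + 1) n) ν).det =
      (∏ i : Fin (k + 1), (fun j : ℕ => if j = 0 then -(↑φ⁻¹ : A) else if j ≤ n then 1 else -1) i) *
        M.det := by
    refine det_eq_prod_mul_det_of_sub_mem_span _ fun i => ?_
    refine Fin.cases ?_ (fun j => ?_) i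
    · have e0 : cycle (d'.swap.mat δ (k + 1) n) ν 0 = (-(↑φ⁻¹ : A)) • M 0 := by
        rw [cycle_zero, hM0]
        funext i
        simp [mat, swap, ν, x, h.g_eq]
      simp only [e0, Fin.val_zero, if_true, sub_self, Submodule.zero_mem]
    by_cases hj : (j : ℕ) < n
    · obtain ⟨u, hu, -, hS⟩ := h.exists_eq j
      have hMS : ∀ l (hl : l + 1 < n + 1), M ⟨l + 1, by omega⟩ =
          fun i : Fin (k + 1) => d.S (l + 1) i := by
        intro l hl
        funext i
        simp [M, mat, swap, show l < n by omega]
      have e1 : cycle (d'.swap.mat δ (k + 1) n) ν j.succ - (1 : A) • M j.succ =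
          (∑ l : Fin j, algebraMap K A (u l) • M ⟨l + 1, by omega⟩) -
            (∑ l ∈ Finset.range (j + 1), u l • (d.f (l + 1) * ↑φ⁻¹)) • M 0 := by
        rw [cycle_succ_of_lt (d'.swap.mat δ (k + 1) n) ν (j := j) hj, hM0]
        have hMj : M j.succ = fun i : Fin (k + 1) => d.S (j + 1) i := hMS j (by omega)
        rw [hMj]
        funext i
        have h1 : d'.swap.mat δ (k + 1) n j.castSucc i = d'.S j i := by simp [mat, swap, hj]
        simp only [Pi.sub_apply, Pi.smul_apply, Finset.sum_apply]
        rw [h1, hS]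
        simp only [smul_sub, Finset.sum_sub_distrib, smul_eq_mul, Finset.sum_mul, one_mul,
          smul_mul_assoc, x]
        rw [Finset.sum_range_succ (fun l => u l • d.S (l + 1) i), hu, one_smul, Finset.sum_range]
        have h2 : ∀ l : Fin j, algebraMap K A (u l) * M ⟨l + 1, by omega⟩ i =
            u l • d.S (l + 1) i := fun l => by rw [hMS l (by omega), Algebra.smul_def]
        rw [Finset.sum_congr rfl fun l _ => h2 l]
        abel
      have e2 : (fun j : ℕ => if j = 0 then -(↑φ⁻¹ : A) else if j ≤ n then 1 else -1) j.succ = 1 := by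
        simp only [Fin.val_succ, Nat.add_one_ne_zero, if_false]
        exact if_pos hj
      rw [e2, e1]
      refine Submodule.sub_mem _ (Submodule.sum_mem _ fun l _ => Submodule.smul_mem _ _
        (Submodule.subset_span ⟨_, ?_, rfl⟩)) (Submodule.smul_mem _ _
          (Submodule.subset_span ⟨0, Fin.succ_pos j, rfl⟩))
      rw [Set.mem_Iio, Fin.lt_def]
      exact Nat.succ_lt_succ l.2
    · have hj := not_lt.1 hj
      have e1 : cycle (d'.swap.mat δ (k + 1) n) ν j.succ =
          fun i : Fin (k + 1) => δ^[(j : ℕ) - n + 1] (-(↑φ⁻¹ * d.S 0 i)) := by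
        rw [cycle_succ_of_le (d'.swap.mat δ (k + 1) n) ν (j := j) hj]
        funext i
        simp [mat, swap, h.g_eq, show ¬ (j : ℕ) + 1 < n by omega,
          show (j : ℕ) + 1 - n = j - n + 1 by omega]
      have e2 : (fun j : ℕ => if j = 0 then -(↑φ⁻¹ : A) else if j ≤ n then 1 else -1) j.succ =
          -1 := by
        simp only [Fin.val_succ, Nat.add_one_ne_zero, if_false]
        exact if_neg (by omega)
      have e3 : M j.succ = x (j - n + 1) := by
        rw [← hMx (j - n) (by omega)]
        exact congrArg M (Fin.ext (by simp only [Fin.val_succ]; omega))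
      rw [e2, e1, e3, ← hc (j - n)]
      refine Submodule.span_le.2 ?_ (hspan _)
      rintro _ ⟨m, hm, rfl⟩
      have hm : m < j - n + 1 := hm
      rcases m with _ | m
      · exact Submodule.subset_span ⟨0, Fin.succ_pos j, hM0⟩
      · refine Submodule.subset_span ⟨⟨n + m + 1, by omega⟩, ?_, hMx m _⟩
        rw [Set.mem_Iio, Fin.lt_def, Fin.val_succ]
        simp only
        omega
  have hprod : ∏ i : Fin (k + 1), (fun j : ℕ => if j = 0 then -(↑φ⁻¹ : A) else
      if j ≤ n then 1 else -1) i = -↑φ⁻¹ * (-1) ^ (k - n) := by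
    rw [Fin.prod_univ_eq_prod_range (fun j : ℕ => if j = 0 then -(↑φ⁻¹ : A) else
      if j ≤ n then 1 else -1), Finset.prod_range_succ']
    obtain ⟨p, rfl⟩ : ∃ p, k = n + p := ⟨k - n, by omega⟩
    rw [Finset.prod_range_add, Finset.prod_congr rfl (g := fun _ => 1), Finset.prod_const_one,
      Finset.prod_congr rfl (g := fun _ => -1), Finset.prod_const, Finset.card_range]
    · rw [if_pos rfl, one_mul, mul_comm, add_tsub_cancel_left]
    · intro j _
      rw [if_neg (by omega), if_neg (by omega)]
    · intro j hj
      have := Finset.mem_range.1 hj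
      rw [if_neg (by omega), if_pos (by omega)]
  rw [det_eq_cycle _ ν, key, hprod]
  obtain ⟨p, rfl⟩ : ∃ p, k = n + p := ⟨k - n, by omega⟩
  have e1 : (-1 : A) ^ n * (-1) ^ n = 1 := by rw [← mul_pow]; simp
  simp only [ν, M, add_tsub_cancel_left, pow_succ, pow_add]
  linear_combination (-((-1) ^ n * (-1) ^ p * (d.swap.mat δ (n + p + 1) (n + 1)).det)) * φ.mul_inv

end SepData

end KP

namespace KP

/-! ### Chains of transformations -/

variable {K A : Type*} [Field K] [CommRing A] [Algebra K A]

namespace SepData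

variable {δ : Derivation K A A} {φ : Aˣ} {d d' d'' : SepData A} {n k : ℕ} {x : A}

/-- Successive transformations, `n` of them with respect to `f_0` and `k` with respect to `g_0`; the
last argument is the product of the inverted functions. -/
inductive Chain (δ : Derivation K A A) : ℕ → ℕ → SepData A → SepData A → A → Prop
  | refl (d : SepData A) : Chain δ 0 0 d d 1
  | db {n k : ℕ} {φ : Aˣ} {d d' d'' : SepData A} {x : A} (h : IsStep δ φ d d')
      (hc : Chain δ n k d' d'' x) : Chain δ (n + 1) k d d'' (φ * x)
  | adj {n k : ℕ} {φ : Aˣ} {d d' d'' : SepData A} {x : A} (h : IsStep δ φ d.swap d'.swap)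
      (hc : Chain δ n k d' d'' x) : Chain δ n (k + 1) d d'' (φ * x)

theorem Chain.tail_db (hc : Chain δ n k d d' x) (h : IsStep δ φ d' d'') :
    Chain δ (n + 1) k d d'' (φ * x) := by
  induction hc with
  | refl d => exact .db h (.refl _)
  | db h' _ ih => exact mul_left_comm (φ : A) _ _ ▸ .db h' (ih h)
  | adj h' _ ih => exact mul_left_comm (φ : A) _ _ ▸ .adj h' (ih h)

theorem Chain.tail_adj (hc : Chain δ n k d d' x) (h : IsStep δ φ d'.swap d''.swap) :
    Chain δ n (k + 1) d d'' (φ * x) := by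
  induction hc with
  | refl d => exact .adj h (.refl _)
  | db h' _ ih => exact mul_left_comm (φ : A) _ _ ▸ .db h' (ih h)
  | adj h' _ ih => exact mul_left_comm (φ : A) _ _ ▸ .adj h' (ih h)

/-- Propagates the determinant formula backwards across one step; signs match modulo even exponents.
On crossing from n < k to k = n + 1 the two formulas agree by transposition. -/
theorem IsStep.eq_det (hd : d.IsSep δ) (h : IsStep δ φ d d')
    (hx : (k ≤ n → x = (-1) ^ (k * (n - k + 1)) * (d'.mat δ n k).det) ∧
      (n ≤ k → x = (-1) ^ (n * (k - n + 1)) * (d'.swap.mat δ k n).det)) :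
    (k ≤ n + 1 → φ * x = (-1) ^ (k * (n + 1 - k + 1)) * (d.mat δ (n + 1) k).det) ∧
      (n + 1 ≤ k → φ * x = (-1) ^ ((n + 1) * (k - (n + 1) + 1)) * (d.swap.mat δ k (n + 1)).det) := by
  have h2 : n + 1 ≤ k →
      φ * x = (-1) ^ ((n + 1) * (k - (n + 1) + 1)) * (d.swap.mat δ k (n + 1)).det := by
    intro hk
    obtain ⟨p, rfl⟩ : ∃ p, k = n + 1 + p := ⟨k - (n + 1), by omega⟩
    rw [hx.2 (by omega), mul_left_comm, h.det_swap_mat hd hk, ← mul_assoc, ← pow_add]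
    congr 1
    rw [show n + 1 + p - n + 1 = p + 1 + 1 by omega, add_tsub_cancel_left,
      show n * (p + 1 + 1) + (n + 1 + p) = (n + 1) * (p + 1) + 2 * n by ring, pow_add, pow_mul _ 2]
    simp
  refine ⟨fun hk => ?_, h2⟩
  rcases Nat.lt_or_ge n k with hnk | hk
  · obtain rfl : k = n + 1 := by omega
    rw [h2 le_rfl, det_mat_swap]
  · obtain ⟨p, rfl⟩ : ∃ p, n = k + p := ⟨n - k, by omega⟩
    rw [hx.1 hk, h.det_mat_succ hk, mul_left_comm, ← mul_assoc _ ((-1) ^ k), ← pow_add]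
    congr 1
    rw [show k + p + 1 - k = p + 1 by omega, add_tsub_cancel_left,
      show k * (p + 1 + 1) + k = k * (p + 1) + 2 * k by ring, pow_add _ _ (2 * k), pow_mul _ 2]
    simp

/-- The tau-quotient as a single determinant. -/
theorem Chain.eq_det (hc : Chain δ n k d d' x) (hd : d.IsSep δ) :
    (k ≤ n → x = (-1) ^ (k * (n - k + 1)) * (d.mat δ n k).det) ∧
      (n ≤ k → x = (-1) ^ (n * (k - n + 1)) * (d.swap.mat δ k n).det) := by
  induction hc with
  | refl d => simp
  | db h _ ih => exact h.eq_det hd (ih (h.isSep hd))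
  -- An adjoint step is a step for the swapped data, and swapping exchanges the two halves of the
  -- statement.
  | adj h _ ih => exact (h.eq_det hd.swap (ih (h.isSep hd.swap).swap).symm).symm

end SepData

end KP

namespace KP

/-! ### Bordered determinants and Wronskians -/

variable {K A : Type*} [Field K] [CommRing A] [Algebra K A]

namespace SepData

variable (d : SepData A) (k : ℕ)

/-- The matrix `(S_{ij})`, `i, j < k`. -/
def sMat : Matrix (Fin k) (Fin k) A := Matrix.of fun i j => d.S i j

/-- The determinant of `(S_{ij})_{i, j < k}` bordered by `f` and the row `s`. -/
def border (s : ℕ) : A :=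
  (Matrix.fromBlocks (d.sMat k) (Matrix.of fun (i : Fin k) (_ : Unit) => d.f i)
    (Matrix.of fun (_ : Unit) (j : Fin k) => d.S s j)
    (Matrix.of fun (_ : Unit) (_ : Unit) => d.f s)).det

/-- The entry in row `s` of the Schur complement of `(S_{ij})_{i, j < k}` for the column `v`. -/
noncomputable def schurCompl (v : ℕ → A) (s : ℕ) : A :=
  v s - ∑ j : Fin k, d.S s j * ((d.sMat k)⁻¹.mulVec (fun i : Fin k => v i)) j

variable {d k} {δ : Derivation K A A}

theorem border_eq (h : IsUnit (d.sMat k).det) (s : ℕ) :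
    d.border k s = (d.sMat k).det * d.schurCompl k d.f s := by
  let _ := (d.sMat k).invertibleOfIsUnitDet h
  rw [border, Matrix.det_fromBlocks₁₁, Matrix.invOf_eq_nonsing_inv, Matrix.mul_assoc]
  exact congrArg _ (Matrix.det_unique _)

theorem det_mat_eq_fromBlocks (p : ℕ) : (d.mat δ (k + p) k).det =
    (Matrix.fromBlocks (d.sMat k) (Matrix.of fun (i : Fin k) (l : Fin p) => δ^[l] (d.f i))
      (Matrix.of fun (s : Fin p) (j : Fin k) => d.S (k + s) j)
      (Matrix.of fun (s l : Fin p) => δ^[l] (d.f (k + s)))).det := by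
  rw [← Matrix.det_transpose, ← Matrix.det_submatrix_equiv_self finSumFinEquiv]
  congr 1
  ext (i | i) (j | j) <;> simp [mat, sMat]

theorem det_mat_add (h : IsUnit (d.sMat k).det) (p : ℕ) : (d.mat δ (k + p) k).det =
    (d.sMat k).det *
      (Matrix.of fun l s : Fin p => d.schurCompl k (fun i => δ^[l] (d.f i)) (k + s)).det := by
  let _ := (d.sMat k).invertibleOfIsUnitDet h
  rw [det_mat_eq_fromBlocks, Matrix.det_fromBlocks₁₁, Matrix.invOf_eq_nonsing_inv,
    ← Matrix.det_transpose (Matrix.of _), Matrix.mul_assoc]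
  rfl

theorem det_mat_add_one : (d.mat δ (k + 1) k).det = d.border k k := by
  rw [det_mat_eq_fromBlocks, border, ← Matrix.det_submatrix_equiv_self
    ((Equiv.refl (Fin k)).sumCongr (Equiv.ofUnique (Fin 1) Unit))]
  congr 1
  ext (i | i) (j | j) <;> simp

/-- With y = S⁻¹v and δS = f gᵀ one gets S δy = δv - (g·y) f. Thus the derivative of the Schur
complement is that of δv, corrected by a multiple, independent of `s`, of the Schur complement of f.
-/
theorem deriv_schurCompl (hd : d.IsSep δ) (h : IsUnit (d.sMat k).det) (v : ℕ → A) (s : ℕ) :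
    δ (d.schurCompl k v s) = d.schurCompl k (fun i => δ (v i)) s -
      (∑ j : Fin k, d.g j * ((d.sMat k)⁻¹.mulVec fun i : Fin k => v i) j) *
        d.schurCompl k d.f s := by
  set y := (d.sMat k)⁻¹.mulVec fun i : Fin k => v i
  set c := ∑ j : Fin k, d.g j * y j
  have hy : (d.sMat k).mulVec y = fun i : Fin k => v i := by
    rw [Matrix.mulVec_mulVec, Matrix.mul_nonsing_inv _ h, Matrix.one_mulVec]
  have hδ : (d.sMat k).mulVec (fun j => δ (y j)) =
      (fun i : Fin k => δ (v i)) - c • fun i : Fin k => d.f i := by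
    funext i
    have := congrArg δ (congrFun hy i)
    simp only [Matrix.mulVec, dotProduct, sMat, Matrix.of_apply, map_sum, Derivation.leibniz,
      smul_eq_mul, hd i, Finset.sum_add_distrib] at this
    simp only [Matrix.mulVec, dotProduct, sMat, Matrix.of_apply, Pi.sub_apply, Pi.smul_apply,
      smul_eq_mul, ← this, c, Finset.sum_mul]
    rw [add_sub_assoc, ← Finset.sum_sub_distrib, left_eq_add]
    exact Finset.sum_eq_zero fun j _ => by ring
  have hδy : (fun j => δ (y j)) = (d.sMat k)⁻¹.mulVec (fun i : Fin k => δ (v i)) -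
      c • (d.sMat k)⁻¹.mulVec fun i : Fin k => d.f i := by
    rw [← Matrix.mulVec_smul, ← Matrix.mulVec_sub, ← hδ, Matrix.mulVec_mulVec,
      Matrix.nonsing_inv_mul _ h, Matrix.one_mulVec]
  have hj : ∀ j, δ (y j) = (d.sMat k)⁻¹.mulVec (fun i : Fin k => δ (v i)) j -
      c * (d.sMat k)⁻¹.mulVec (fun i : Fin k => d.f i) j := fun j => congrFun hδy j
  have hc : ∑ j : Fin k, y j * (d.f s * d.g j) = d.f s * c := by
    rw [Finset.mul_sum]
    exact Finset.sum_congr rfl fun j _ => by ring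
  have hsum : ∀ j : Fin k, δ (d.S s j * y j) =
      d.S s j * (d.sMat k)⁻¹.mulVec (fun i : Fin k => δ (v i)) j -
        c * (d.S s j * (d.sMat k)⁻¹.mulVec (fun i : Fin k => d.f i) j) +
          y j * (d.f s * d.g j) := by
    intro j
    rw [Derivation.leibniz, hd, hj, smul_eq_mul, smul_eq_mul]
    ring
  rw [schurCompl, map_sub, map_sum, Finset.sum_congr rfl fun j _ => hsum j, Finset.sum_add_distrib,
    Finset.sum_sub_distrib, hc, ← Finset.mul_sum, schurCompl, schurCompl]
  ring

/-- The derivatives of the bordered determinants reduce, modulo lower rows, to det S times the Schur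
complements of δ^l f, giving (det S)^p. The determinant of these complements times det S is `mat`;
the extra factor on the left avoids division. -/
theorem det_border (hd : d.IsSep δ) (h : IsUnit (d.sMat k).det) (p : ℕ) :
    (Matrix.of fun α β : Fin p => δ^[α] (d.border k (k + β))).det * (d.sMat k).det =
      (d.sMat k).det ^ p * (d.mat δ (k + p) k).det := by
  let x : ℕ → Fin p → A := fun m s => d.schurCompl k (fun i => δ^[m] (d.f i)) (k + s)
  have hx : ∀ m, (fun i => δ (x m i)) - (1 : A) • x (m + 1) ∈
      Submodule.span A (x '' Set.Iio (m + 1)) := by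
    intro m
    have e : (fun i => δ (x m i)) - (1 : A) • x (m + 1) =
        (-∑ j : Fin k, d.g j * ((d.sMat k)⁻¹.mulVec fun i : Fin k => δ^[m] (d.f i)) j) • x 0 := by
      funext s
      simp only [Pi.sub_apply, Pi.smul_apply, x, deriv_schurCompl hd h, one_smul,
        Function.iterate_succ_apply', smul_eq_mul, Function.iterate_zero, id]
      ring
    rw [e]
    exact Submodule.smul_mem _ _ (Submodule.subset_span ⟨0, m.succ_pos, rfl⟩)
  rw [det_eq_prod_mul_det_of_sub_mem_span (M := Matrix.of fun l s : Fin p => x l s)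
    (fun _ => (d.sMat k).det), det_mat_add h, Finset.prod_const, Finset.card_univ,
    Fintype.card_fin]
  · ring
  intro l
  have := iterate_deriv_sub_mem_span δ x (fun _ => 1) hx (d := 0) (c := (d.sMat k).det)
    (y := fun s : Fin p => d.border k (k + s)) (by
      convert Submodule.zero_mem _ using 1
      funext s
      simp [x, border_eq h]) l
  simp only [Finset.prod_const_one, mul_one, zero_add] at this
  refine Submodule.span_mono ?_ this
  rintro _ ⟨m, hm, rfl⟩
  exact ⟨⟨m, lt_trans hm l.2⟩, hm, rfl⟩

theorem intPow_mul_det_border (hd : d.IsSep δ) {n : ℕ} (hk : k ≤ n)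
    (h : k + 1 < n → IsUnit (d.sMat k).det) :
    intPow ((-1) ^ k * (d.sMat k).det) (-((n : ℤ) - k - 1)) *
      (Matrix.of fun α β : Fin (n - k) => δ^[α] (d.border k (k + β))).det =
      (-1) ^ (k * (n - k + 1)) * (d.mat δ n k).det := by
  obtain ⟨p, rfl⟩ := Nat.exists_eq_add_of_le hk
  rw [add_tsub_cancel_left]
  rcases p with _ | _ | p
  -- For n = k the exponent is 1 and the Wronskian is empty; for n = k + 1 the exponent is 0 and one
  -- bordered determinant remains. Invertibility matters only from n = k + 2 on.
  · have e : -(((k + 0 : ℕ) : ℤ) - k - 1) = Int.ofNat 1 := by simp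
    rw [e, intPow, Matrix.det_fin_zero, add_zero, ← Matrix.det_transpose (d.mat δ k k)]
    have e2 : (d.mat δ k k).transpose = d.sMat k := by
      ext i j
      simp [mat, sMat]
    rw [e2]
    simp
  · have e : -(((k + (0 + 1) : ℕ) : ℤ) - k - 1) = Int.ofNat 0 := by push_cast; ring
    rw [e, intPow, det_mat_add_one]
    simp [mul_comm k, pow_mul]
  · have e : -(((k + (p + 1 + 1) : ℕ) : ℤ) - k - 1) = Int.negSucc p := by
      rw [Int.negSucc_eq]; push_cast; ring
    obtain ⟨u, hu⟩ := h (by omega)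
    have hdet := det_border hd ⟨u, hu⟩ (p + 1 + 1)
    have e2 : ((-1) ^ k * (d.sMat k).det) = (((-1) ^ k * u : Aˣ) : A) := by simp [hu]
    have hW : (Matrix.of fun α β : Fin (p + 1 + 1) => δ^[α] (d.border k (k + β))).det =
        (u : A) ^ (p + 1) * (d.mat δ (k + (p + 1 + 1)) k).det := by
      refine (Units.mul_left_inj u).1 ?_
      rw [hu, hdet]
      ring
    have hv : (u : A) = (-1) ^ k * (((-1) ^ k * u : Aˣ) : A) := by
      simp [← mul_assoc, ← mul_pow]
    rw [e, intPow, e2, Ring.inverse_unit, hW, hv, mul_pow, ← pow_mul]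
    generalize (-1) ^ k * u = w
    have hw : (↑w⁻¹ : A) ^ (p + 1) * (w : A) ^ (p + 1) = 1 := by
      rw [← mul_pow, Units.inv_mul, one_pow]
    rw [show k * (p + 1 + 1 + 1) = k * (p + 1) + 2 * k by ring, pow_add _ _ (2 * k), pow_mul _ 2,
      neg_one_sq, one_pow]
    linear_combination (-1) ^ (k * (p + 1)) * (d.mat δ (k + (p + 1 + 1)) k).det * hw

end SepData

end KP

namespace KP

/-! ### The orbit of a hierarchy -/

variable {K A : Type*} [Field K] [CommRing A] [Algebra K A]

namespace Hierarchy

open SepData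

variable {t : Times K A} {m : ℕ} {r : ℕ+} {a b : Fin m} {X Y : Hierarchy t m}

/-- The functions `χ_a^{(i)}`, `χ_b^{*(j)}` and their potentials. -/
noncomputable def sepData (X : Hierarchy t m) (a b : Fin m) : SepData A :=
  ⟨X.chi a, X.chiStar b, X.sep a b⟩

theorem IsDB.isStep {φ : Aˣ} (hY : IsDB a φ X Y) (h : X.IsCoherent r a b) (hab : a ≠ b) :
    IsStep (t.d 1) φ (X.sepData a b) (Y.sepData a b) where
  unit_eq := hY.unit_eq
  g_eq j := by
    simp only [sepData, Hierarchy.sep]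
    rw [hY.chi_zero]
    exact hY.chiStar_eq h hab j
  exists_eq i := by
    obtain ⟨u, hu, hf⟩ := hY.exists_chi_eq h i
    refine ⟨u, hu, hf, fun j => ?_⟩
    simp only [sepData, Hierarchy.sep]
    rw [hf, hY.chiStar_eq h hab j, map_sum, LinearMap.sum_apply]
    refine Finset.sum_congr rfl fun l _ => ?_
    rw [map_smul, LinearMap.smul_apply, hY.S_eq (X.chi_mem_chiSpan a _), hY.chi_zero]

theorem IsAdjDB.isStep {ψ : Aˣ} (hY : IsAdjDB b ψ X Y) (h : X.IsCoherent r a b) (hab : a ≠ b) :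
    IsStep (t.d 1) ψ (X.sepData a b).swap (Y.sepData a b).swap where
  unit_eq := hY.unit_eq
  g_eq j := by
    simp only [sepData, SepData.swap, Hierarchy.sep]
    rw [hY.chiStar_zero]
    exact hY.chi_eq h hab j
  exists_eq i := by
    obtain ⟨u, hu, hf⟩ := hY.exists_chiStar_eq h i
    refine ⟨u, hu, hf, fun j => ?_⟩
    simp only [sepData, SepData.swap, Hierarchy.sep]
    rw [hf, hY.chi_eq h hab j, map_sum]
    refine Finset.sum_congr rfl fun l _ => ?_
    rw [map_smul, hY.S_eq (X.chiStar_mem_chiStarSpan b _), hY.chiStar_zero]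

/-- An orbit grows at its end, whereas the determinant induction removes the first step; appending
to a `Chain` reconciles the two. Coherence is carried along because each step needs it for the
current hierarchy. -/
theorem Orbit.exists_chain {X₀ : Hierarchy t m} (h₀ : X₀.IsCoherent r a b) (hab : a ≠ b) {n k : ℕ}
    (hX : Orbit a b X₀ n k X) : X.IsCoherent r a b ∧
      Chain (t.d 1) n k (X₀.sepData a b) (X.sepData a b) (X.τ / X₀.τ : Aˣ) := by
  induction hX with
  | start => exact ⟨h₀, by simpa using Chain.refl _⟩
  | db φ h hXY ih =>
    obtain ⟨hc, hchain⟩ := ih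
    refine ⟨hXY.isCoherent hc hab, ?_⟩
    have := hchain.tail_db (hXY.isStep hc hab)
    have e : _ = _ * _ := Units.ext (hXY.tau.trans (congrArg (· * _) hXY.unit_eq.symm))
    rwa [← Units.val_mul, ← mul_div_assoc, ← e] at this
  | adj ψ h hXY ih =>
    obtain ⟨hc, hchain⟩ := ih
    refine ⟨hXY.isCoherent hc hab, ?_⟩
    have := hchain.tail_adj (hXY.isStep hc hab)
    have e : _ = _ * _ := Units.ext (hXY.tau.trans (congrArg (· * _) hXY.unit_eq.symm))
    rwa [← Units.val_mul, ← mul_div_assoc, ← e] at this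

theorem border_swap_sepData (X : Hierarchy t m) (a b : Fin m) (n s : ℕ) :
    (X.sepData a b).swap.border n s = X.borderChiStar a b n s := by
  rw [SepData.border, borderChiStar, ← Matrix.det_transpose]
  congr 1
  ext (i | i) (j | j) <;> rfl

theorem det_sMat_swap_sepData (X : Hierarchy t m) (a b : Fin m) (n : ℕ) :
    ((X.sepData a b).swap.sMat n).det = (X.sepMatrix a b n).det := by
  rw [← Matrix.det_transpose]
  rfl

end Hierarchy

end KP

/-! ### The tau-function formula on the orbit. -/

theorem mainTheorem10 {K A : Type*} [Field K] [CharZero K] [CommRing A] [Algebra K A]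
    (t : KP.Times K A) (m : ℕ) (r : ℕ+) (a b : Fin m) (hab : a ≠ b)
    (X₀ : KP.Hierarchy t m) (Q : KP.PsiDO (t.d 1))
    (hX₀ : X₀.IsCKP r Q) (hS : X₀.IsSEP r Q a b)
    (n k : ℕ) (X : KP.Hierarchy t m) (hX : KP.Hierarchy.Orbit a b X₀ n k X) :
    (k ≤ n → (k + 1 < n → IsUnit (X₀.sepMatrix a b k).det) →
      ((X.τ / X₀.τ : Aˣ) : A) =
        KP.intPow ((-1) ^ k * (X₀.sepMatrix a b k).det) (-((n : ℤ) - k - 1)) *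
          KP.wronskian t (fun l : Fin (n - k) => X₀.borderChi a b k (k + l))) ∧
    (n ≤ k → (n + 1 < k → IsUnit (X₀.sepMatrix a b n).det) →
      ((X.τ / X₀.τ : Aˣ) : A) =
        KP.intPow ((-1) ^ n * (X₀.sepMatrix a b n).det) (-((k : ℤ) - n - 1)) *
          KP.wronskian t (fun l : Fin (k - n) => X₀.borderChiStar a b n (n + l))) := by
  obtain ⟨-, hchain⟩ := hX.exists_chain (hX₀.isCoherent hS) hab
  have hd : (X₀.sepData a b).IsSep (t.d 1) := (hX₀.isCoherent hS).dx_sep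
  obtain ⟨h1, h2⟩ := hchain.eq_det hd
  refine ⟨fun hk hu => (h1 hk).trans (KP.SepData.intPow_mul_det_border hd hk hu).symm,
    fun hn hu => (h2 hn).trans ?_⟩
  rw [← KP.Hierarchy.det_sMat_swap_sepData] at hu ⊢
  simp only [← KP.Hierarchy.border_swap_sepData]
  exact (KP.SepData.intPow_mul_det_border hd.swap hn hu).symm
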